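/- Let $\mathcal B_1,\dots,\mathcal B_\mu$ be orthonormal bases of $\mathbb C^6$ that are pairwise mutually unbiased, i.e. $|\langle\psi,\varphi\rangle|^2=\tfrac16$ for all $\psi\in\mathcal B_k$, $\varphi\in\mathcal B_l$ with $k\neq l$. Suppose that the collection is monomial, in the following sense: there is a unitary matrix $U\in\mathbb C^{6\times 6}$ such that for every $k$ the vectors of the rotated basis $U^\dagger\mathcal B_k=\{U^\dagger\psi:\psi\in\mathcal B_k\}$ are common eigenvectors of all members of a maximal commuting class $\mathcal C_k$ that contains only monomial matrices. Here a maximal commuting class is a set of $6$ pairwise commuting unitary $6\times 6$ matrices, one of which is the identity, that are pairwise orthogonal with respect to the trace inner product $(A,B)\mapsto\operatorname{tr}(A^\dagger B)$, and a matrix is monomial if each of its rows and each of its columns has exactly one nonzero entry. Then $\mu\le 3$. -/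

import Mathlib

/-- Two orthonormal bases of `ℂⁿ` are mutually unbiased if `|⟨bᵢ, b'ⱼ⟩|² = 1 / n` for all `i, j`. -/
def MutuallyUnbiased {n : ℕ} (b b' : OrthonormalBasis (Fin n) ℂ (EuclideanSpace ℂ (Fin n))) :
    Prop :=
  ∀ i j, ‖inner ℂ (b i) (b' j)‖ ^ 2 = 1 / (n : ℝ)

/-- A matrix is monomial if every row and every column has exactly one nonzero entry. -/
def IsMonomialMatrix {n : ℕ} (A : Matrix (Fin n) (Fin n) ℂ) : Prop :=
  (∀ i, ∃! j, A i j ≠ 0) ∧ ∀ j, ∃! i, A i j ≠ 0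

/-- A maximal commuting class: `n` pairwise commuting unitary `n × n` matrices, the identity
among them, that are pairwise orthogonal with respect to the trace inner product. (Such a class
is maximal, since there cannot be more than `n` commuting unitaries of this kind.) -/
structure IsMaximalCommutingClass {n : ℕ} (C : Finset (Matrix (Fin n) (Fin n) ℂ)) : Prop where
  card_eq : C.card = n
  one_mem : 1 ∈ C
  unitary : ∀ A ∈ C, A ∈ Matrix.unitaryGroup (Fin n) ℂ
  commute : ∀ A ∈ C, ∀ B ∈ C, Commute A B
  orthogonal : ∀ A ∈ C, ∀ B ∈ C, A ≠ B → (A.conjTranspose * B).trace = 0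

/-- The vectors `v i` are common eigenvectors of all the matrices in `C`. -/
def AreCommonEigenvectors {n : ℕ} (C : Finset (Matrix (Fin n) (Fin n) ℂ))
    (v : Fin n → EuclideanSpace ℂ (Fin n)) : Prop :=
  ∀ A ∈ C, ∀ i, ∃ c : ℂ, Module.End.HasEigenvector (Matrix.toEuclideanLin A) c (v i)

/-- A collection `B 1, …, B μ` of orthonormal bases of `ℂⁿ` is monomial if, for one unitary
matrix `U`, each of the rotated bases `Uᴴ (B k)` consists of the common eigenvectors of a maximal
commuting class all of whose members are monomial matrices. -/
def IsMonomialCollection {n m : ℕ}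
    (B : Fin m → OrthonormalBasis (Fin n) ℂ (EuclideanSpace ℂ (Fin n))) : Prop :=
  ∃ U ∈ Matrix.unitaryGroup (Fin n) ℂ, ∀ k, ∃ C : Finset (Matrix (Fin n) (Fin n) ℂ),
    IsMaximalCommutingClass C ∧
    AreCommonEigenvectors C (fun i => Matrix.toEuclideanLin U.conjTranspose (B k i)) ∧
    ∀ A ∈ C, IsMonomialMatrix A

/-! After rotation by `U` every basis is a common eigenbasis `v` of a class of monomial matrices.
The span of the class contains the projections `v i (v i)ᴴ`, so two coordinates in the support of
one vector are linked by a nonzero entry of some member, and such an entry forces `|v j p| = |v j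
q|` for all `j`. Hence each basis splits into blocks: vectors are flat on their supports, and
supports are equal or disjoint. The bases are then sorted by whether the supports are full.

Bases that are not full: unbiasedness gives `6 |S ∩ S'| = |S| |S'|` for supports `S`, `S'` of
different bases, and a basis that is not full has a support of size at most 3. Two such supports
have sizes 2 and 3, so three such bases cannot coexist (`false_of_not_full`).

Full bases: the permutations under the class act as `ℤ/2 × ℤ/3`, and every flat vector unbiased to
the basis becomes a cyclic six-root after division by `v 0`. The Fourier transform over `ℤ/3` sends
cyclic six-roots to spectral pairs, which are flat (`b = ± i a`) or real with an explicit profile.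
Unbiasedness excludes two flat pairs and two real pairs, and for a flat and a real pair it fixes the
sign in `± i`. So, of two mutually unbiased bases of cyclic six-roots, one is entirely flat with a
common sign; two of its coordinates are then proportional over the whole basis, against unitarity.
Three full bases cannot coexist (`false_of_full`).

Four bases would therefore be two of each kind. The supports of sizes 2 and 3 restrict the ratios of
the products `conj (w p) * w' p`, for `w`, `w'` from the full bases, to signs and cube roots of
unity. Their sum is then an Eisenstein integer times a number of known modulus, and unbiasedness
would need an Eisenstein integer of norm 6, which does not exist (`false_of_edge_of_triangle`). -/

open Complex ComplexConjugate

/-! ### Spectral pairs: the dichotomy flat or real. -/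

/-- The Fourier transforms `a`, `b` over `ℤ/3` of the two halves of a cyclic six-root. -/
structure SpectralPair (a b : Fin 3 → ℂ) : Prop where
  normSq_add : ∀ j, normSq (a j) + normSq (b j) = 6
  re_mul : ∀ j, (a j * conj (b j)).re = 0
  left : a 0 * conj (a 1) + a 1 * conj (a 2) + a 2 * conj (a 0) = 0
  right : b 0 * conj (b 1) + b 1 * conj (b 2) + b 2 * conj (b 0) = 0
  sum_left : normSq (a 0) + normSq (a 1) + normSq (a 2) = 9

theorem re_of_pow_three_eq_one {z : ℂ} (hz : z ^ 3 = 1) :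
    (z.re = 1 ∧ z.im = 0) ∨ (z.re = -1 / 2 ∧ z.im ^ 2 = 3 / 4) := by
  have h : (z - 1) * (z ^ 2 + z + 1) = 0 := by linear_combination hz
  rcases mul_eq_zero.1 h with h | h
  · left
    rw [sub_eq_zero.1 h]
    simp
  · right
    have h1 := congrArg re h
    have h2 := congrArg im h
    simp [pow_two] at h1 h2
    have h3 : z.im * (2 * z.re + 1) = 0 := by linear_combination h2
    rcases mul_eq_zero.1 h3 with h3 | h3
    · rw [h3] at h1
      nlinarith [sq_nonneg (z.re + 1 / 2)]
    · have : z.re = -1 / 2 := by linarith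
      refine ⟨this, ?_⟩
      rw [this] at h1
      linarith

theorem conj_of_pow_three_eq_one {z : ℂ} (hz : z ^ 3 = 1) : conj z = z ^ 2 := by
  have hn : normSq z = 1 := by
    rw [normSq_apply]
    rcases re_of_pow_three_eq_one hz with ⟨h1, h2⟩ | ⟨h1, h2⟩
    · rw [h1, h2]; norm_num
    · rw [h1]; linarith
  have h : z * conj z = 1 := by rw [mul_conj, hn]; simp
  have h0 : z ≠ 0 := by rintro rfl; simp at hz
  apply mul_left_cancel₀ h0
  rw [h, ← hz]; ring

/-- With `w = x + i y`, the imaginary part of `w ^ 3` is `y (3 x² - y²)`, which vanishes on the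
three real lines spanned by the cube roots of unity. -/
theorem exists_real_of_pow_three_im_eq_zero {w : ℂ} (h : (w ^ 3).im = 0) :
    ∃ (z : ℂ) (t : ℝ), z ^ 3 = 1 ∧ w = z * t := by
  have h3 : (√3 : ℝ) ^ 2 = 3 := Real.sq_sqrt (by norm_num)
  have h' : w.im * ((√3 * w.re - w.im) * (√3 * w.re + w.im)) = 0 := by
    simp [pow_succ] at h
    linear_combination h + w.im * w.re ^ 2 * h3
  have hc : ((√3 : ℝ) : ℂ) ^ 2 = 3 := by exact_mod_cast h3
  have key : ∀ s : ℂ, s ^ 2 = 1 → (-1 / 2 + s * (√3 : ℝ) / 2 * I) ^ 3 = 1 := by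
    intro s hs
    have : (-1 / 2 + s * (√3 : ℝ) / 2 * I) ^ 2 = - 1 - (-1 / 2 + s * (√3 : ℝ) / 2 * I) := by
      linear_combination (s ^ 2 * (√3 : ℝ) ^ 2 / 4) * I_sq - (√3 : ℝ) ^ 2 / 4 * hs - 1 / 4 * hc
    linear_combination (-1 / 2 + s * (√3 : ℝ) / 2 * I - 1) * this
  rcases mul_eq_zero.1 h' with h' | h'
  · refine ⟨1, w.re, by simp, ?_⟩
    apply Complex.ext <;> simp [h']
  rcases mul_eq_zero.1 h' with h' | h'
  · refine ⟨_, -2 * w.re, key (-1) (by norm_num), ?_⟩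
    apply Complex.ext <;> simp <;> linarith
  · refine ⟨_, -2 * w.re, key 1 (by norm_num), ?_⟩
    apply Complex.ext <;> simp <;> linarith

/-- The first kind of spectral pair: `b = ± i a`. -/
def SpectralPair.IsFlat (s : ℝ) (a b : Fin 3 → ℂ) : Prop :=
  s ^ 2 = 1 ∧ ∀ j, b j = s * I * a j

/-- The second kind of spectral pair: `a` and `i b` are real up to a phase and a modulation. -/
def SpectralPair.IsReal (e z : ℂ) (x y : Fin 3 → ℝ) (a b : Fin 3 → ℂ) : Prop :=
  normSq e = 1 ∧ z ^ 3 = 1 ∧ ∀ j : Fin 3, a j = e * z ^ (j : ℕ) * x j ∧ b j = e * z ^ (j : ℕ) * I * y j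

namespace SpectralPair

variable {a b a' b' : Fin 3 → ℂ}

/-- If one entry of `a` vanished, `left` would make a second one vanish, and the third would have
squared modulus 9, above the bound 6. -/
theorem ne_zero (h : SpectralPair a b) (j : Fin 3) : a j ≠ 0 := by
  intro h0
  have hl := h.left
  have hs := h.sum_left
  have n0 := h.normSq_add 0
  have n1 := h.normSq_add 1
  have n2 := h.normSq_add 2
  have p0 := normSq_nonneg (b 0)
  have p1 := normSq_nonneg (b 1)
  have p2 := normSq_nonneg (b 2)
  fin_cases j <;> simp at h0 <;> simp [h0] at hl hs n0 n1 n2 <;>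
  · rcases hl with hl | hl <;> simp [hl] at hs n0 n1 n2 <;> linarith

theorem exists_eq_mul (h : SpectralPair a b) (j : Fin 3) : ∃ t : ℝ, b j = t * I * a j := by
  have h0 := h.ne_zero j
  have hn : normSq (a j) ≠ 0 := by simpa using h0
  refine ⟨(b j * conj (a j)).im / normSq (a j), ?_⟩
  have h1 : b j * conj (a j) = (b j * conj (a j)).im * I := by
    have := h.re_mul j
    apply Complex.ext
    · simp at this ⊢
      linarith
    · simp
  have h2 : ((normSq (a j) : ℝ) : ℂ) ≠ 0 := by exact_mod_cast hn
  push_cast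
  field_simp
  rw [← mul_conj]
  linear_combination a j * h1

/-- Put `b j = i t j a j`. The cyclic products `P`, `Q`, `R` of `a` satisfy two real linear
relations, with coefficients `1, 1, 1` and `t 0 t 1, t 1 t 2, t 2 t 0`. If these are proportional,
all `t j` agree and the pair is flat. Otherwise `P`, `Q`, `R` are real multiples of one another; as
`P Q R = |a 0 a 1 a 2|²` is real, so is `P ^ 3`, and the phase of `P` is a cube root of unity up to
sign. -/
theorem isFlat_or_isReal (h : SpectralPair a b) :
    (∃ s, IsFlat s a b) ∨ ∃ e z x y, IsReal e z x y a b := by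
  choose t ht using h.exists_eq_mul
  have h0 := h.ne_zero
  set P := a 0 * conj (a 1) with hP
  set Q := a 1 * conj (a 2) with hQ
  set R := a 2 * conj (a 0) with hR
  have hsum : P + Q + R = 0 := h.left
  have hsum' : (t 0 * t 1 : ℂ) * P + (t 1 * t 2 : ℂ) * Q + (t 2 * t 0 : ℂ) * R = 0 := by
    have := h.right
    rw [ht, ht, ht] at this
    simp only [map_mul, conj_ofReal, conj_I] at this
    linear_combination this + (t 0 * t 1 * P + t 1 * t 2 * Q + t 2 * t 0 * R : ℂ) * I_sq
  have hdep : ((t 0 * t 1 - t 2 * t 0 : ℝ) : ℂ) * P + ((t 1 * t 2 - t 2 * t 0 : ℝ) : ℂ) * Q = 0 := by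
    push_cast
    linear_combination hsum' - (t 2 * t 0 : ℂ) * hsum
  have hn : ∀ j, normSq (a j) * (1 + t j ^ 2) = 6 := by
    intro j
    have := h.normSq_add j
    rw [ht] at this
    simp at this
    linear_combination this
  have hP0 : P ≠ 0 := mul_ne_zero (h0 0) (by simpa using h0 1)
  have hQ0 : Q ≠ 0 := mul_ne_zero (h0 1) (by simpa using h0 2)
  by_cases hc : (t 0 * t 1 - t 2 * t 0 = 0 ∧ t 1 * t 2 - t 2 * t 0 = 0)
  · left
    have hs := h.sum_left
    have n0 := hn 0
    have n1 := hn 1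
    have n2 := hn 2
    have p0 := normSq_nonneg (a 0)
    have p1 := normSq_nonneg (a 1)
    have p2 := normSq_nonneg (a 2)
    -- Two vanishing `t j` would give two entries of squared modulus 6, exceeding the total 9.
    have hh : t 0 = t 1 ∧ t 0 = t 2 := by
      have c1 : t 0 * (t 1 - t 2) = 0 := by linarith [hc.1]
      have c2 : t 2 * (t 1 - t 0) = 0 := by linarith [hc.2]
      have c3 : t 1 * (t 0 - t 2) = 0 := by linarith [hc.1, hc.2]
      rcases mul_eq_zero.1 c1 with c1 | c1
      · rcases mul_eq_zero.1 c2 with c2 | c2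
        · rw [c1] at n0; rw [c2] at n2; linarith
        · have : t 1 = 0 := by linarith
          rw [c1] at n0; rw [this] at n1; linarith
      · rcases mul_eq_zero.1 c2 with c2 | c2
        · have : t 1 = 0 := by linarith
          rw [c2] at n2; rw [this] at n1; linarith
        · constructor <;> linarith
    refine ⟨t 0, ?_, ?_⟩
    · rw [← hh.1] at n1; rw [← hh.2] at n2
      have : 9 * (1 + t 0 ^ 2) = 18 := by rw [← hs]; linarith
      linarith
    · intro j
      rw [ht j]
      fin_cases j
      · rfl
      · simp [hh.1]
      · simp [← hh.2]
  · right
    have hreal : ∃ ρ : ℝ, Q = ρ * P := by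
      by_cases hz : t 1 * t 2 - t 2 * t 0 = 0
      · rw [hz] at hdep
        simp only [ofReal_zero, zero_mul, add_zero, mul_eq_zero, hP0, or_false, ofReal_eq_zero] at hdep
        exact absurd ⟨hdep, hz⟩ hc
      · refine ⟨-(t 0 * t 1 - t 2 * t 0) / (t 1 * t 2 - t 2 * t 0), ?_⟩
        have hz' : ((t 1 * t 2 - t 2 * t 0 : ℝ) : ℂ) ≠ 0 := by exact_mod_cast hz
        rw [ofReal_div, div_mul_eq_mul_div, eq_div_iff hz']
        push_cast at hdep ⊢
        linear_combination hdep
    obtain ⟨ρ, hρ⟩ := hreal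
    have hρ0 : ρ ≠ 0 := by
      rintro rfl
      simp at hρ
      exact hQ0 hρ
    have hR0 : R = -(1 + ρ) * P := by linear_combination hsum - hρ
    have hρ1 : -(1 + ρ) ≠ 0 := by
      intro hh
      have hR1 : R ≠ 0 := mul_ne_zero (h0 2) (by simpa using h0 0)
      apply hR1
      rw [hR0]
      have : (-(1 + ρ) : ℂ) = 0 := by exact_mod_cast hh
      rw [this, zero_mul]
    have hcube : ((ρ * -(1 + ρ) : ℝ) : ℂ) * P ^ 3
        = ((normSq (a 0) * normSq (a 1) * normSq (a 2) : ℝ) : ℂ) := by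
      push_cast
      rw [← mul_conj, ← mul_conj, ← mul_conj]
      have : P * Q * R = (a 0 * conj (a 0)) * (a 1 * conj (a 1)) * (a 2 * conj (a 2)) := by
        rw [hP, hQ, hR]; ring
      rw [← this, hR0, hρ]
      ring
    have him : (P ^ 3).im = 0 := by
      have := congrArg im hcube
      rw [im_ofReal_mul, ofReal_im] at this
      exact (mul_eq_zero.1 this).resolve_left (mul_ne_zero hρ0 hρ1)
    obtain ⟨z, r, hz, hr⟩ := exists_real_of_pow_three_im_eq_zero him
    have hzc := conj_of_pow_three_eq_one hz
    have hN : ((‖a 0‖ : ℝ) : ℂ) ≠ 0 := by simpa using h0 0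
    have hNN : a 0 * conj (a 0) = (‖a 0‖ : ℂ) ^ 2 := by
      rw [mul_conj, normSq_eq_norm_sq]; push_cast; rfl
    have e1 : a 1 * (‖a 0‖ : ℂ) ^ 2 = a 0 * z ^ 2 * r := by
      have := congrArg conj hr
      rw [hP] at this
      simp only [map_mul, conj_conj, conj_ofReal, hzc] at this
      rw [← hNN]
      linear_combination a 0 * this
    -- The factor `z` of `R` is written as `z ^ 4`, so that `a` is modulated by the powers of `z ^
    -- 2`.
    have e2 : a 2 * (‖a 0‖ : ℂ) ^ 2 = a 0 * z ^ 4 * (-(1 + ρ) * r) := by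
      rw [← hNN]
      have : a 2 * conj (a 0) = -(1 + ρ) * (z * r) := by rw [← hr, ← hR0]
      linear_combination a 0 * this + a 0 * z * (1 + ρ) * r * hz
    obtain ⟨x, main⟩ : ∃ x : Fin 3 → ℝ,
        ∀ j : Fin 3, a j = a 0 / ‖a 0‖ * (z ^ 2) ^ (j : ℕ) * x j := by
      refine ⟨![‖a 0‖, r / ‖a 0‖, -(1 + ρ) * r / ‖a 0‖], fun j => ?_⟩
      fin_cases j
      · simp; field_simp
      · simp; field_simp; linear_combination e1
      · simp; field_simp; linear_combination e2
    refine ⟨a 0 / ‖a 0‖, z ^ 2, x, fun j => t j * x j, ?_, ?_, fun j => ⟨main j, ?_⟩⟩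
    · rw [normSq_eq_norm_sq]
      simp [h0 0]
    · rw [← pow_mul, mul_comm, pow_mul, hz, one_pow]
    · conv_lhs => rw [ht j, main j]
      push_cast
      ring

end SpectralPair

/-! ### The explicit profile of real spectral pairs. -/

namespace SpectralPair

/-- The real part of the exceptional cyclic six-roots. -/
noncomputable def exceptionalCos : ℝ := (√3 - 1) / 2

/-- The imaginary part of the exceptional cyclic six-roots. -/
noncomputable def exceptionalSin : ℝ := √(1 / 2 + exceptionalCos)

local notation "c" => exceptionalCos
local notation "σ" => exceptionalSin

theorem exceptionalCos_sq : c ^ 2 + c = 1 / 2 := by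
  have h3 : (√3 : ℝ) ^ 2 = 3 := Real.sq_sqrt (by norm_num)
  rw [exceptionalCos]
  linear_combination h3 / 4

theorem exceptionalCos_pos : 0 < c := by
  have h : (1 : ℝ) < √3 := by
    rw [Real.lt_sqrt] <;> norm_num
  rw [exceptionalCos]
  linarith

theorem exceptionalSin_sq : σ ^ 2 = 1 / 2 + c :=
  Real.sq_sqrt (by linarith [exceptionalCos_pos])

/-- The profile of the real spectral pairs. -/
noncomputable def profile : Fin 3 → ℝ := ![1, c - σ, c + σ]

/-- The transposition that exchanges the two exceptional entries of the profile. -/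
def flip : Equiv.Perm (Fin 3) := Equiv.swap 1 2

/-- Eliminating `q` shows that each `p k` is a root of one quadratic, whose coefficients depend only
on the sum and the sum of squares of `p`. Three distinct roots are impossible. -/
theorem exists_eq_of_sum {p q : Fin 3 → ℝ} (hpq : ∀ j, p j ^ 2 + q j ^ 2 = 1)
    (hp : p 0 + p 1 + p 2 = √3) (hq : q 0 + q 1 + q 2 = 0)
    (ho : p 0 * q 0 + p 1 * q 1 + p 2 * q 2 = 0) : p 0 = p 1 ∨ p 1 = p 2 ∨ p 0 = p 2 := by
  by_contra! hne
  obtain ⟨h01, h12, h02⟩ := hne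
  set N := p 0 ^ 2 + p 1 ^ 2 + p 2 ^ 2 with hN
  have key : ∀ i j k : Fin 3, p i + p j + p k = √3 → q i + q j + q k = 0 →
      p i * q i + p j * q j + p k * q k = 0 → p i ^ 2 + p j ^ 2 + p k ^ 2 = N →
      p i ≠ p j → 2 * √3 * p k ^ 2 - (√3 ^ 2 + 2 * N - 3) * p k + √3 * N - √3 = 0 := by
    intro i j k h1 h2 h3 h4 h5
    have e : q i * (p i - p k) = - (q j * (p j - p k)) := by
      have : q k = - q i - q j := by linarith
      rw [this] at h3
      linarith
    have e2 : (1 - p i ^ 2) * (p i - p k) ^ 2 = (1 - p j ^ 2) * (p j - p k) ^ 2 := by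
      have i1 : 1 - p i ^ 2 = q i ^ 2 := by linarith [hpq i]
      have i2 : 1 - p j ^ 2 = q j ^ 2 := by linarith [hpq j]
      rw [i1, i2, ← mul_pow, ← mul_pow, e]
      ring
    apply mul_left_cancel₀ (sub_ne_zero.2 h5)
    rw [← h4, ← h1]
    linear_combination -e2
  have k0 := key 0 1 2 hp hq ho rfl h01
  have k1 := key 1 2 0 (by linarith) (by linarith) (by linarith) (by rw [hN]; ring) h12
  have k2 := key 0 2 1 (by linarith) (by linarith) (by linarith) (by rw [hN]; ring) h02
  have s3 : √3 ≠ 0 := by positivity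
  have l1 : 2 * √3 * (p 2 + p 0) - (√3 ^ 2 + 2 * N - 3) = 0 := by
    apply mul_left_cancel₀ (sub_ne_zero.2 h02)
    linear_combination k1 - k0
  have l2 : 2 * √3 * (p 2 + p 1) - (√3 ^ 2 + 2 * N - 3) = 0 := by
    apply mul_left_cancel₀ (sub_ne_zero.2 h12)
    linear_combination k2 - k0
  apply h01
  apply mul_left_cancel₀ s3
  linarith

/-- Orthogonality reads `(p₀ - p₂) (q₀ + q₁) = 0`. The first factor cannot vanish: all `p` would be
`√3 / 3`, all `q² = 2 / 3`, and the `q` could not sum to 0. So `q₂ = 0` and `p₂ = ± 1`; the value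
`-1` would push `p₀` above 1. -/
theorem eq_exceptional {p₀ p₁ p₂ q₀ q₁ q₂ : ℝ} (h₀ : p₀ ^ 2 + q₀ ^ 2 = 1)
    (h₁ : p₁ ^ 2 + q₁ ^ 2 = 1) (h₂ : p₂ ^ 2 + q₂ ^ 2 = 1)
    (hp : p₀ + p₁ + p₂ = √3) (hq : q₀ + q₁ + q₂ = 0)
    (ho : p₀ * q₀ + p₁ * q₁ + p₂ * q₂ = 0) (h : p₀ = p₁) :
    p₂ = 1 ∧ p₀ = c ∧ p₁ = c ∧ q₂ = 0 ∧ (q₀ = σ ∧ q₁ = -σ ∨ q₀ = -σ ∧ q₁ = σ) := by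
  have h3 : (√3 : ℝ) ^ 2 = 3 := Real.sq_sqrt (by norm_num)
  subst h
  have h2 : q₂ = -q₀ - q₁ := by linarith
  subst h2
  have e : (p₀ - p₂) * (q₀ + q₁) = 0 := by linear_combination ho
  have hs : q₀ + q₁ = 0 := by
    refine (mul_eq_zero.1 e).resolve_left fun h => ?_
    have : p₂ = p₀ := by linarith
    subst this
    have hpp : p₂ ^ 2 = 1 / 3 := by
      have : p₂ = √3 / 3 := by linarith
      rw [this]; linear_combination h3 / 9
    nlinarith [sq_nonneg (q₀ + q₁), sq_nonneg (q₀ - q₁)]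
  have h1' : q₁ = -q₀ := by linarith
  subst h1'
  have hp2 : (p₂ - 1) * (p₂ + 1) = 0 := by linear_combination h₂
  have hp2' : p₂ = 1 := by
    rcases mul_eq_zero.1 hp2 with h | h
    · linarith
    · exfalso
      have : p₂ = -1 := by linarith
      subst this
      have : 1 < p₀ := by
        have : (1 : ℝ) < √3 := by rw [Real.lt_sqrt] <;> norm_num
        linarith
      nlinarith [sq_nonneg q₀]
  subst hp2'
  have hc : p₀ = c := by rw [exceptionalCos]; linarith
  refine ⟨rfl, hc, hc, by ring, ?_⟩
  have : (q₀ - σ) * (q₀ + σ) = 0 := by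
    rw [hc] at h₀
    linear_combination h₀ - exceptionalSin_sq - exceptionalCos_sq
  rcases mul_eq_zero.1 this with h | h
  · left; constructor <;> linarith
  · right; constructor <;> linarith

theorem exists_perm : ∀ i j k : Fin 3, i ≠ j → j ≠ k → i ≠ k →
    ∃ π : Equiv.Perm (Fin 3), π i = 0 ∧ π j = 1 ∧ π k = 2 := by
  decide

theorem exists_eq_profile {p q : Fin 3 → ℝ} (hpq : ∀ j, p j ^ 2 + q j ^ 2 = 1)
    (hp : p 0 + p 1 + p 2 = √3) (hq : q 0 + q 1 + q 2 = 0)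
    (ho : p 0 * q 0 + p 1 * q 1 + p 2 * q 2 = 0) :
    ∃ π : Equiv.Perm (Fin 3), ∀ j, p j + q j = profile (π j) ∧ p j - q j = profile (flip (π j)) := by
  obtain ⟨i, j, k, hij, hjk, hik, hk, hi, hj, hk', hi', hj'⟩ : ∃ i j k : Fin 3, i ≠ j ∧ j ≠ k ∧
      i ≠ k ∧ p k = 1 ∧ p i = c ∧ p j = c ∧ q k = 0 ∧ q i = σ ∧ q j = -σ := by
    have key : ∀ i j k : Fin 3, i ≠ j → j ≠ k → i ≠ k → p i + p j + p k = √3 →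
        q i + q j + q k = 0 → p i * q i + p j * q j + p k * q k = 0 → p i = p j →
        ∃ i j k : Fin 3, i ≠ j ∧ j ≠ k ∧
        i ≠ k ∧ p k = 1 ∧ p i = c ∧ p j = c ∧ q k = 0 ∧ q i = σ ∧ q j = -σ := by
      intro i j k hij hjk hik h1 h2 h3 h4
      obtain ⟨a1, a2, a3, a4, ⟨a5, a6⟩ | ⟨a5, a6⟩⟩ :=
        eq_exceptional (hpq i) (hpq j) (hpq k) h1 h2 h3 h4
      · exact ⟨i, j, k, hij, hjk, hik, a1, a2, a3, a4, a5, a6⟩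
      · exact ⟨j, i, k, hij.symm, hik, hjk, a1, a3, a2, a4, a6, a5⟩
    rcases exists_eq_of_sum hpq hp hq ho with h | h | h
    · exact key 0 1 2 (by decide) (by decide) (by decide) hp hq ho h
    · exact key 1 2 0 (by decide) (by decide) (by decide) (by linarith) (by linarith)
        (by linarith) h
    · exact key 0 2 1 (by decide) (by decide) (by decide) (by linarith) (by linarith)
        (by linarith) h
  obtain ⟨π, h0, h1, h2⟩ := exists_perm k j i hjk.symm hij.symm hik.symm
  refine ⟨π, fun l => ?_⟩
  have hl : l = i ∨ l = j ∨ l = k := by omega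
  rcases hl with rfl | rfl | rfl
  · rw [h2, hi, hi']; simp [profile, flip]
  · rw [h1, hj, hj']; simp [profile, flip, sub_eq_add_neg]
  · rw [h0, hk, hk']; simp [profile, flip, Equiv.swap_apply_of_ne_of_ne]

theorem exists_real_eq_profile {x y : Fin 3 → ℝ} (hxy : ∀ j, x j ^ 2 + y j ^ 2 = 6)
    (hx : x 0 * x 1 + x 1 * x 2 + x 2 * x 0 = 0) (hy : y 0 * y 1 + y 1 * y 2 + y 2 * y 0 = 0)
    (hs : x 0 ^ 2 + x 1 ^ 2 + x 2 ^ 2 = 9) :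
    ∃ (ε δ : ℝ) (π : Equiv.Perm (Fin 3)), ε ^ 2 = 1 ∧ δ ^ 2 = 1 ∧
      ∀ j, x j = √3 * ε * profile (π j) ∧ y j = √3 * δ * profile (flip (π j)) := by
  have h3 : (√3 : ℝ) ^ 2 = 3 := Real.sq_sqrt (by norm_num)
  set ε := (x 0 + x 1 + x 2) / 3 with hε
  set δ := (y 0 + y 1 + y 2) / 3 with hδ
  have ε2 : ε ^ 2 = 1 := by rw [hε]; linear_combination hs / 9 + 2 / 9 * hx
  have hs' : y 0 ^ 2 + y 1 ^ 2 + y 2 ^ 2 = 9 := by linarith [hxy 0, hxy 1, hxy 2]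
  have δ2 : δ ^ 2 = 1 := by rw [hδ]; linear_combination hs' / 9 + 2 / 9 * hy
  -- The sums of `x` and of `y` are `3 ε` and `3 δ` with signs `ε`, `δ`. Rotating `(ε x, δ y)` by 45
  -- degrees and scaling to unit length turns the equality of the two square sums into orthogonality
  -- of `p` and `q`.
  obtain ⟨π, hπ⟩ := exists_eq_profile (p := fun j => √3 * (ε * x j + δ * y j) / 6)
    (q := fun j => √3 * (ε * x j - δ * y j) / 6)
    (fun j => by
      linear_combination (1 / 6) * hxy j + ((ε * x j) ^ 2 + (δ * y j) ^ 2) / 18 * h3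
        + (x j ^ 2 * ε2 + y j ^ 2 * δ2) / 6)
    (by
      have e1 : ε * (x 0 + x 1 + x 2) = 3 := by
        linear_combination 3 * ε2 - 3 * ε * hε
      have e2 : δ * (y 0 + y 1 + y 2) = 3 := by
        linear_combination 3 * δ2 - 3 * δ * hδ
      linear_combination √3 / 6 * (e1 + e2))
    (by
      have e1 : ε * (x 0 + x 1 + x 2) = 3 := by
        linear_combination 3 * ε2 - 3 * ε * hε
      have e2 : δ * (y 0 + y 1 + y 2) = 3 := by
        linear_combination 3 * δ2 - 3 * δ * hδ
      linear_combination √3 / 6 * (e1 - e2))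
    (by
      linear_combination √3 ^ 2 / 36 * ((x 0 ^ 2 + x 1 ^ 2 + x 2 ^ 2) * ε2
        - (y 0 ^ 2 + y 1 ^ 2 + y 2 ^ 2) * δ2 + hs - hs'))
  refine ⟨ε, δ, π, ε2, δ2, fun j => ⟨?_, ?_⟩⟩
  · rw [← (hπ j).1]
    linear_combination - ε ^ 2 * x j / 3 * h3 - x j * ε2
  · rw [← (hπ j).2]
    linear_combination - δ ^ 2 * y j / 3 * h3 - y j * δ2

/-- The two expressions are the possible values of `|M 0 + z M 1 + z² M 2|²` for a cube root of
unity `z`; unbiasedness would make one of them 6. For each sign and each permutation this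
contradicts `c² + c = 1 / 2` and `σ² = 1 / 2 + c`. -/
theorem profile_correlation (ρ : Equiv.Perm (Fin 3)) {κ : ℝ} (hκ : κ ^ 2 = 1) (M : Fin 3 → ℝ)
    (hM : ∀ i, M i = profile i * profile (ρ i) + κ * profile (flip i) * profile (flip (ρ i))) :
    (M 0 + M 1 + M 2) ^ 2 ≠ 6 ∧
      M 0 ^ 2 + M 1 ^ 2 + M 2 ^ 2 - M 0 * M 1 - M 1 * M 2 - M 2 * M 0 ≠ 6 := by
  have hc := exceptionalCos_sq
  have hs := exceptionalSin_sq
  have hρ : ∀ ρ : Equiv.Perm (Fin 3), (ρ 0 = 0 ∧ ρ 1 = 1 ∧ ρ 2 = 2) ∨ (ρ 0 = 0 ∧ ρ 1 = 2 ∧ ρ 2 = 1)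
      ∨ (ρ 0 = 1 ∧ ρ 1 = 0 ∧ ρ 2 = 2) ∨ (ρ 0 = 1 ∧ ρ 1 = 2 ∧ ρ 2 = 0) ∨
      (ρ 0 = 2 ∧ ρ 1 = 0 ∧ ρ 2 = 1) ∨ (ρ 0 = 2 ∧ ρ 1 = 1 ∧ ρ 2 = 0) := by decide
  have f0 : flip 0 = 0 := by decide
  have f1 : flip 1 = 2 := by decide
  have f2 : flip 2 = 1 := by decide
  have p0 : profile 0 = 1 := rfl
  have p1 : profile 1 = c - σ := rfl
  have p2 : profile 2 = c + σ := rfl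
  have hκ' : κ = 1 ∨ κ = -1 := by simpa using hκ
  rcases hκ' with rfl | rfl <;>
  rcases hρ ρ with ⟨h0, h1, h2⟩ | ⟨h0, h1, h2⟩ | ⟨h0, h1, h2⟩ | ⟨h0, h1, h2⟩ | ⟨h0, h1, h2⟩ |
    ⟨h0, h1, h2⟩ <;>
  · rw [hM 0, hM 1, hM 2, h0, h1, h2, f0, f1, f2, p0, p1, p2]
    constructor <;> intro h <;> grind

end SpectralPair

/-! ### Pairings of flat and real spectral pairs. -/

namespace SpectralPair

local notation "c" => exceptionalCos
local notation "σ" => exceptionalSin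

variable {a b a' b' : Fin 3 → ℂ}

/-- The inner product of two spectral pairs. -/
def pairing (a b a' b' : Fin 3 → ℂ) : ℂ :=
  ∑ j, (conj (a j) * a' j + conj (b j) * b' j)

theorem normSq_sum_pow {z : ℂ} (hz : z ^ 3 = 1) (m : Fin 3 → ℝ) :
    normSq (m 0 + z * m 1 + z ^ 2 * m 2) = (m 0 + m 1 + m 2) ^ 2 ∨
    normSq (m 0 + z * m 1 + z ^ 2 * m 2) =
      m 0 ^ 2 + m 1 ^ 2 + m 2 ^ 2 - m 0 * m 1 - m 1 * m 2 - m 2 * m 0 := by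
  rw [← conj_of_pow_three_eq_one hz, normSq_apply]
  rcases re_of_pow_three_eq_one hz with ⟨h1, h2⟩ | ⟨h1, h2⟩
  · left
    simp [h1, h2]
    ring
  · right
    simp [h1]
    linear_combination (m 1 - m 2) ^ 2 * h2

/-- Phase and modulation multiply all three cyclic products by the same factor, so the relations
`left` and `right` descend to the real vectors `x` and `y`. -/
theorem IsReal.exists_profile (h : SpectralPair a b) {e z : ℂ} {x y : Fin 3 → ℝ}
    (hr : IsReal e z x y a b) :
    ∃ (ε δ : ℝ) (π : Equiv.Perm (Fin 3)), ε ^ 2 = 1 ∧ δ ^ 2 = 1 ∧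
      ∀ j, x j = √3 * ε * profile (π j) ∧ y j = √3 * δ * profile (flip (π j)) := by
  obtain ⟨he, hz, hab⟩ := hr
  have hzc := conj_of_pow_three_eq_one hz
  have hec : e * conj e = 1 := by rw [mul_conj, he]; simp
  have hz0 : z ≠ 0 := by rintro rfl; simp at hz
  have hzn : normSq z = 1 := by
    have h1 : ((normSq z : ℝ) : ℂ) = 1 := by rw [← mul_conj, hzc, ← hz]; ring
    exact_mod_cast h1
  have hna : ∀ j, normSq (a j) = x j ^ 2 := by
    intro j
    rw [(hab j).1]
    simp [he, hzn, pow_two]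
  have hnb : ∀ j, normSq (b j) = y j ^ 2 := by
    intro j
    rw [(hab j).2]
    simp [he, hzn, pow_two]
  apply exists_real_eq_profile
  · intro j
    rw [← hna, ← hnb, h.normSq_add]
  · have := h.left
    rw [(hab 0).1, (hab 1).1, (hab 2).1] at this
    simp only [map_mul, map_pow, hzc, conj_ofReal, Fin.val_zero, Fin.val_one, Fin.val_two] at this
    have h2 : z ^ 2 * ((x 0 * x 1 + x 1 * x 2 + x 2 * x 0 : ℝ) : ℂ) = 0 := by
      push_cast
      linear_combination this - z ^ 2 * (x 0 * x 1 + z ^ 3 * x 1 * x 2 + x 2 * x 0) * hec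
        - z ^ 2 * x 1 * x 2 * hz
    exact_mod_cast (mul_eq_zero.1 h2).resolve_left (pow_ne_zero 2 hz0)
  · have := h.right
    rw [(hab 0).2, (hab 1).2, (hab 2).2] at this
    simp only [map_mul, map_pow, hzc, conj_ofReal, conj_I, Fin.val_zero, Fin.val_one,
      Fin.val_two] at this
    have h2 : z ^ 2 * ((y 0 * y 1 + y 1 * y 2 + y 2 * y 0 : ℝ) : ℂ) = 0 := by
      push_cast
      linear_combination this - z ^ 2 * (y 0 * y 1 + z ^ 3 * y 1 * y 2 + y 2 * y 0) * hec
        - z ^ 2 * y 1 * y 2 * hz +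
        e * conj e * z ^ 2 * (y 0 * y 1 + z ^ 3 * y 1 * y 2 + y 2 * y 0) * I_sq
    exact_mod_cast (mul_eq_zero.1 h2).resolve_left (pow_ne_zero 2 hz0)
  · rw [← hna, ← hna, ← hna, h.sum_left]

/-- The phases drop out and the modulations combine into a single cube root of unity, so the pairing
reduces to the correlation of two permuted profiles. -/
theorem IsReal.normSq_pairing_ne (h : SpectralPair a b) (h' : SpectralPair a' b')
    {e z e' z' : ℂ} {x y x' y' : Fin 3 → ℝ}
    (hr : IsReal e z x y a b) (hr' : IsReal e' z' x' y' a' b') :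
    normSq (pairing a b a' b') ≠ 54 := by
  obtain ⟨ε, δ, π, hε, hδ, hπ⟩ := hr.exists_profile h
  obtain ⟨ε', δ', π', hε', hδ', hπ'⟩ := hr'.exists_profile h'
  obtain ⟨he, hz, hab⟩ := hr
  obtain ⟨he', hz', hab'⟩ := hr'
  have hzc := conj_of_pow_three_eq_one hz
  set m : Fin 3 → ℝ := fun j => x j * x' j + y j * y' j with hm
  have hp : pairing a b a' b' = conj e * e' * (m 0 + z ^ 2 * z' * m 1 + (z ^ 2 * z') ^ 2 * m 2) := by
    rw [pairing, Fin.sum_univ_three]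
    simp only [(hab _).1, (hab _).2, (hab' _).1, (hab' _).2, map_mul, map_pow, hzc, conj_ofReal,
      conj_I, Fin.val_zero, Fin.val_one, Fin.val_two, hm]
    push_cast
    linear_combination (-conj e * e' * (y 0 * y' 0 + z ^ 2 * z' * y 1 * y' 1 +
      (z ^ 2 * z') ^ 2 * y 2 * y' 2)) * I_sq
  have hζ : (z ^ 2 * z') ^ 3 = 1 := by
    linear_combination z' ^ 3 * (z ^ 3 + 1) * hz + hz'
  have h3 : (√3 : ℝ) ^ 2 = 3 := Real.sq_sqrt (by norm_num)
  set κ := ε * ε' * δ * δ' with hκ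
  have hκ2 : κ ^ 2 = 1 := by
    rw [hκ, mul_pow, mul_pow, mul_pow, hε, hε', hδ, hδ']; norm_num
  set M : Fin 3 → ℝ := fun i => profile i * profile ((π.symm.trans π') i)
    + κ * profile (flip i) * profile (flip ((π.symm.trans π') i)) with hMdef
  obtain ⟨hM1, hM2⟩ := profile_correlation (π.symm.trans π') hκ2 M (fun i => rfl)
  have hmM : ∀ j, m j = 3 * (ε * ε') * M (π j) := by
    intro j
    simp only [hm, hMdef, (hπ j).1, (hπ j).2, (hπ' j).1, (hπ' j).2, Equiv.trans_apply,
      Equiv.symm_apply_apply, hκ]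
    linear_combination (ε * profile (π j) * (ε' * profile (π' j)) +
      δ * profile (flip (π j)) * (δ' * profile (flip (π' j)))) * h3
      - 3 * δ * profile (flip (π j)) * (δ' * profile (flip (π' j))) * (ε ^ 2 * hε' + hε)
  have s1 : m 0 + m 1 + m 2 = 3 * (ε * ε') * (M 0 + M 1 + M 2) := by
    have := Equiv.sum_comp π M
    rw [Fin.sum_univ_three, Fin.sum_univ_three] at this
    rw [hmM, hmM, hmM]
    linear_combination 3 * (ε * ε') * this
  have s2 : m 0 ^ 2 + m 1 ^ 2 + m 2 ^ 2 = 9 * (M 0 ^ 2 + M 1 ^ 2 + M 2 ^ 2) := by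
    have := Equiv.sum_comp π (fun i => M i ^ 2)
    rw [Fin.sum_univ_three, Fin.sum_univ_three] at this
    rw [hmM, hmM, hmM]
    linear_combination 9 * this +
      9 * (M (π 0) ^ 2 + M (π 1) ^ 2 + M (π 2) ^ 2) * (ε ^ 2 * hε' + hε)
  have s3 : (m 0 + m 1 + m 2) ^ 2 = 9 * (M 0 + M 1 + M 2) ^ 2 := by
    rw [s1]
    linear_combination 9 * (M 0 + M 1 + M 2) ^ 2 * (ε ^ 2 * hε' + hε)
  intro h54
  rw [hp, normSq_mul, normSq_mul, normSq_conj, he, he', one_mul, one_mul] at h54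
  rcases normSq_sum_pow hζ m with hh | hh
  · rw [hh, s3] at h54
    exact hM1 (by linarith)
  · rw [hh] at h54
    -- The quadratic form is symmetric, equal to `3/2 Σ m² - 1/2 (Σ m)²`, hence insensitive to the
    -- relabelling by `π`.
    apply hM2
    linear_combination h54 / 9 - (3 / 2 * s2 - 1 / 2 * s3) / 9

theorem IsFlat.normSq_eq (h : SpectralPair a b) {s : ℝ} (hf : IsFlat s a b) (j : Fin 3) :
    normSq (a j) = 3 := by
  have h1 := h.normSq_add j
  rw [hf.2 j] at h1
  have hs := hf.1
  simp at h1
  have : normSq (a j) * (1 + s ^ 2) = 6 := by linear_combination h1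
  rw [hs] at this
  linarith

/-- The three products have equal modulus and sum 0, so by conjugation their second symmetric
function vanishes too. Each then has its square equal to the product of the other two, and its cube
equal to `n³`. -/
theorem _root_.exists_cube_root_of_cyclic_sum {n : ℝ} (hn : n ≠ 0) {p q r : ℂ} (hp : normSq p = n)
    (hq : normSq q = n) (hr : normSq r = n)
    (h : p * conj q + q * conj r + r * conj p = 0) :
    ∃ z : ℂ, z ^ 3 = 1 ∧ p * conj q = n * z := by
  have hn' : (n : ℂ) ≠ 0 := by exact_mod_cast hn
  have hp' : p * conj p = n := by rw [mul_conj, hp]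
  have hq' : q * conj q = n := by rw [mul_conj, hq]
  have hr' : r * conj r = n := by rw [mul_conj, hr]
  have h' := congrArg conj h
  simp only [map_add, map_mul, conj_conj, map_zero] at h'
  have hsq : (p * conj q) ^ 2 = (q * conj r) * (r * conj p) := by
    have e2 : (n : ℂ) * ((p * conj q) * (q * conj r) + (q * conj r) * (r * conj p)
        + (r * conj p) * (p * conj q)) = 0 := by
      linear_combination n * n * h' + n * p * conj r * hq' + n * q * conj p * hr'
        + n * r * conj q * hp'
    have e3 := (mul_eq_zero.1 e2).resolve_left hn'
    linear_combination p * conj q * h - e3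
  refine ⟨p * conj q / n, ?_, by field_simp⟩
  rw [div_pow, div_eq_one_iff_eq (pow_ne_zero 3 hn')]
  linear_combination p * conj q * hsq + (q * conj q * r * conj r) * hp' + n * r * conj r * hq'
    + n ^ 2 * hr'

theorem IsFlat.exists_cube_root (h : SpectralPair a b) {s : ℝ} (hf : IsFlat s a b) (i j : Fin 3) :
    ∃ z : ℂ, z ^ 3 = 1 ∧ a i * conj (a j) = 3 * z := by
  have h3 := hf.normSq_eq h
  have hl := h.left
  have key : ∀ i j k : Fin 3, a i * conj (a j) + a j * conj (a k) + a k * conj (a i) = 0 →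
      ∃ z : ℂ, z ^ 3 = 1 ∧ a i * conj (a j) = 3 * z := fun i j k hh => by
    exact_mod_cast exists_cube_root_of_cyclic_sum (by norm_num) (h3 i) (h3 j) (h3 k) hh
  have diag : ∀ i, ∃ z : ℂ, z ^ 3 = 1 ∧ a i * conj (a i) = 3 * z := fun i =>
    ⟨1, by simp, by rw [mul_conj, h3]; simp⟩
  have symm : ∀ i j, (∃ z : ℂ, z ^ 3 = 1 ∧ a i * conj (a j) = 3 * z) →
      ∃ z : ℂ, z ^ 3 = 1 ∧ a j * conj (a i) = 3 * z := by
    rintro i j ⟨z, hz, hh⟩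
    refine ⟨conj z, by rw [← map_pow, hz, map_one], ?_⟩
    have := congrArg conj hh
    simp only [map_mul, conj_conj, map_ofNat] at this
    rw [mul_comm, this]
  have k01 := key 0 1 2 hl
  have k12 := key 1 2 0 (by linear_combination hl)
  have k20 := key 2 0 1 (by linear_combination hl)
  fin_cases i <;> fin_cases j
  exacts [diag 0, k01, symm _ _ k20, symm _ _ k01, diag 1, k12, k20, symm _ _ k12, diag 2]

/-- The pairing is `1 + s s'`, which is 0 or 2, times a sum of three numbers of modulus 3 whose
relative phases are cube roots of unity. The squared modulus is 0, 108, 216 or 324. -/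
theorem IsFlat.normSq_pairing_ne (h : SpectralPair a b) (h' : SpectralPair a' b') {s s' : ℝ}
    (hf : IsFlat s a b) (hf' : IsFlat s' a' b') : normSq (pairing a b a' b') ≠ 54 := by
  set κ : Fin 3 → ℂ := fun j => conj (a j) * a' j with hκ
  have hp : pairing a b a' b' = ((1 + s * s' : ℝ) : ℂ) * (κ 0 + κ 1 + κ 2) := by
    rw [pairing, Fin.sum_univ_three]
    simp only [hf.2, hf'.2, map_mul, conj_I, conj_ofReal, hκ]
    push_cast
    linear_combination (-s * s' * (conj (a 0) * a' 0 + conj (a 1) * a' 1 + conj (a 2) * a' 2)) * I_sq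
  have hn : ∀ j, normSq (κ j) = 9 := fun j => by
    simp only [hκ, normSq_mul, normSq_conj, hf.normSq_eq h, hf'.normSq_eq h']
    norm_num
  have hz : ∀ i j, (κ i * conj (κ j)).re = 9 ∨ (κ i * conj (κ j)).re = - 9 / 2 := by
    intro i j
    obtain ⟨z, hz, e⟩ := hf.exists_cube_root h j i
    obtain ⟨z', hz', e'⟩ := hf'.exists_cube_root h' i j
    have : κ i * conj (κ j) = ((9 : ℝ) : ℂ) * (z * z') := by
      simp only [hκ, map_mul, conj_conj]
      push_cast
      linear_combination a' i * conj (a' j) * e + 3 * z * e'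
    rw [this, re_ofReal_mul]
    rcases re_of_pow_three_eq_one (z := z * z') (by rw [mul_pow, hz, hz', one_mul]) with h | h
    · left; rw [h.1]; norm_num
    · right; rw [h.1]; norm_num
  have hsum : normSq (κ 0 + κ 1 + κ 2) = 27 + 2 * ((κ 0 * conj (κ 1)).re
      + (κ 0 * conj (κ 2)).re + (κ 1 * conj (κ 2)).re) := by
    rw [Complex.normSq_add, Complex.normSq_add, hn, hn, hn, add_mul, add_re]
    ring
  have hss : (1 + s * s') ^ 2 = 0 ∨ (1 + s * s') ^ 2 = 4 := by
    have : (s * s') ^ 2 = 1 := by rw [mul_pow, hf.1, hf'.1, one_mul]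
    rcases (by simpa using this : s * s' = 1 ∨ s * s' = -1) with h | h
    · right; rw [h]; norm_num
    · left; rw [h]; norm_num
  intro h54
  rw [hp, normSq_mul, normSq_ofReal, ← pow_two, hsum] at h54
  rcases hss with hh | hh <;> rw [hh] at h54 <;> rcases hz 0 1 with h1 | h1 <;>
    rcases hz 0 2 with h2 | h2 <;> rcases hz 1 2 with h3 | h3 <;> rw [h1, h2, h3] at h54 <;>
    norm_num at h54

/-- For the opposite sign the pairing sees only `profile - profile ∘ flip = (0, -2σ, 2σ)`. Its
squared modulus is then `12 σ²` times 0 or 9, and `108 σ² = 54 + 108 c` exceeds 54. -/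
theorem IsFlat.eq_of_normSq_pairing (h : SpectralPair a b) {s ε δ : ℝ} (hf : IsFlat s a b)
    {e z : ℂ} {x y : Fin 3 → ℝ} (hr : IsReal e z x y a' b') {π : Equiv.Perm (Fin 3)}
    (hε : ε ^ 2 = 1) (hδ : δ ^ 2 = 1)
    (hπ : ∀ j, x j = √3 * ε * profile (π j) ∧ y j = √3 * δ * profile (flip (π j)))
    (hp : normSq (pairing a b a' b') = 54) : s = ε * δ := by
  have hs : (s * δ) ^ 2 = ε ^ 2 := by rw [mul_pow, hf.1, hδ, hε, one_mul]
  rcases sq_eq_sq_iff_eq_or_eq_neg.1 hs with hs | hs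
  · linear_combination δ * hs - s * hδ
  exfalso
  obtain ⟨he, hz, hab⟩ := hr
  have hzn : normSq z = 1 := by
    have h1 : ((normSq z : ℝ) : ℂ) = 1 := by
      rw [← mul_conj, conj_of_pow_three_eq_one hz, ← hz]; ring
    exact_mod_cast h1
  set κ : Fin 3 → ℂ := fun i => conj (a (π.symm i)) * z ^ ((π.symm i : Fin 3) : ℕ) with hκ
  have hpair : pairing a b a' b' =
      e * ((√3 * ε * (2 * exceptionalSin) : ℝ) : ℂ) * (κ 2 - κ 1) := by
    have e1 : ∀ j, conj (a j) * a' j + conj (b j) * b' j =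
        e * ((√3 * ε : ℝ) : ℂ) *
          (κ (π j) * ((profile (π j) - profile (flip (π j)) : ℝ) : ℂ)) := by
      intro j
      have hs' : (s : ℂ) * δ = -ε := by exact_mod_cast hs
      rw [(hab j).1, (hab j).2, hf.2, (hπ j).1, (hπ j).2]
      simp only [map_mul, conj_I, conj_ofReal, hκ, Equiv.symm_apply_apply]
      push_cast
      linear_combination (-s * conj (a j) * e * z ^ (j : ℕ) * √3 * δ * profile (flip (π j))) * I_sq
        + conj (a j) * e * z ^ (j : ℕ) * √3 * profile (flip (π j)) * hs'
    rw [pairing, Finset.sum_congr rfl (fun j _ => e1 j), ← Finset.mul_sum,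
      Equiv.sum_comp π (fun i => κ i * ((profile i - profile (flip i) : ℝ) : ℂ)),
      Fin.sum_univ_three]
    have f0 : flip 0 = 0 := by decide
    have f1 : flip 1 = 2 := by decide
    have f2 : flip 2 = 1 := by decide
    rw [f0, f1, f2]
    have p1 : profile 1 = c - σ := rfl
    have p2 : profile 2 = c + σ := rfl
    rw [p1, p2]
    push_cast
    ring
  have hκn : ∀ i, normSq (κ i) = 3 := fun i => by
    simp [hκ, hf.normSq_eq h, hzn]
  have hre : (κ 2 * conj (κ 1)).re = 3 ∨ (κ 2 * conj (κ 1)).re = -3 / 2 := by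
    obtain ⟨w, hw, ew⟩ := hf.exists_cube_root h (π.symm 1) (π.symm 2)
    set i := ((π.symm 1 : Fin 3) : ℕ)
    set j := ((π.symm 2 : Fin 3) : ℕ)
    have : κ 2 * conj (κ 1) = ((3 : ℝ) : ℂ) * (w * (z ^ j * z ^ (2 * i))) := by
      simp only [hκ, map_mul, conj_conj, map_pow, conj_of_pow_three_eq_one hz, ← pow_mul]
      push_cast
      linear_combination z ^ j * z ^ (2 * i) * ew
    rw [this, re_ofReal_mul]
    rcases re_of_pow_three_eq_one (z := w * (z ^ j * z ^ (2 * i))) (by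
      rw [mul_pow, mul_pow, hw, ← pow_mul, ← pow_mul, mul_comm j, mul_comm (2 * i), pow_mul,
        pow_mul z 3, hz]; simp) with h | h
    · left; rw [h.1]; norm_num
    · right; rw [h.1]; norm_num
  have h3 : (√3 : ℝ) ^ 2 = 3 := Real.sq_sqrt (by norm_num)
  have hd : normSq (κ 2 - κ 1) = 6 - 2 * (κ 2 * conj (κ 1)).re := by
    rw [normSq_sub, hκn, hκn]; ring
  rw [hpair, normSq_mul, normSq_mul, he, normSq_ofReal, hd] at hp
  have hσ := exceptionalSin_sq
  have hc := exceptionalCos_pos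
  have hp' : 12 * σ ^ 2 * (6 - 2 * (κ 2 * conj (κ 1)).re) = 54 := by
    rw [← hp]
    linear_combination -(4 * σ ^ 2 * (6 - 2 * (κ 2 * conj (κ 1)).re)) * (ε ^ 2 * h3 + 3 * hε)
  rcases hre with hh | hh <;> rw [hh, hσ] at hp' <;> linarith

end SpectralPair

/-! ### Cyclic six-roots and the Fourier transform on `ℤ/3`. -/

/-- A cyclic six-root: a unimodular function on `ℤ/2 × ℤ/3` without autocorrelation, given by
its two halves. -/
structure CyclicSixRoot (u v : Fin 3 → ℂ) : Prop where
  normSq_left : ∀ t, normSq (u t) = 1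
  normSq_right : ∀ t, normSq (v t) = 1
  even : ∑ t, (conj (u t) * u (t + 1) + conj (v t) * v (t + 1)) = 0
  odd : ∀ k, ∑ t, (conj (u t) * v (t + k) + conj (v t) * u (t + k)) = 0

/-- A primitive cube root of unity. -/
noncomputable def cubeRoot : ℂ := ⟨-1 / 2, √3 / 2⟩

theorem cubeRoot_sq_add : cubeRoot ^ 2 + cubeRoot + 1 = 0 := by
  have h3 : (√3 : ℝ) ^ 2 = 3 := Real.sq_sqrt (by norm_num)
  apply Complex.ext
  · simp [cubeRoot, pow_two]
    linear_combination -h3 / 4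
  · simp [cubeRoot, pow_two]
    ring

theorem cubeRoot_pow_three : cubeRoot ^ 3 = 1 := by
  linear_combination (cubeRoot - 1) * cubeRoot_sq_add

/-- The Fourier transform on `ℤ/3`. -/
noncomputable def fourierThree (u : Fin 3 → ℂ) : Fin 3 → ℂ :=
  ![u 0 + u 1 + u 2, u 0 + cubeRoot * u 1 + cubeRoot ^ 2 * u 2,
    u 0 + cubeRoot ^ 2 * u 1 + cubeRoot * u 2]

theorem fourierThree_zero (u : Fin 3 → ℂ) : fourierThree u 0 = u 0 + u 1 + u 2 := rfl

theorem fourierThree_one (u : Fin 3 → ℂ) :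
    fourierThree u 1 = u 0 + cubeRoot * u 1 + cubeRoot ^ 2 * u 2 := rfl

theorem fourierThree_two (u : Fin 3 → ℂ) :
    fourierThree u 2 = u 0 + cubeRoot ^ 2 * u 1 + cubeRoot * u 2 := rfl

theorem conj_cubeRoot : conj cubeRoot = cubeRoot ^ 2 :=
  conj_of_pow_three_eq_one cubeRoot_pow_three

theorem conj_fourierThree_mul (u v : Fin 3 → ℂ) :
    ∑ j, conj (fourierThree u j) * fourierThree v j = 3 * ∑ t, conj (u t) * v t := by
  simp only [Fin.sum_univ_three, fourierThree_zero, fourierThree_one, fourierThree_two, map_add,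
    map_mul, map_pow, conj_cubeRoot]
  have h := cubeRoot_sq_add
  have h3 := cubeRoot_pow_three
  set w := cubeRoot
  generalize conj (u 0) = x0, conj (u 1) = x1, conj (u 2) = x2
  grind

theorem fourierThree_injective : Function.Injective fourierThree := by
  intro u v h
  have h0 := congrFun h 0
  have h1 := congrFun h 1
  have h2 := congrFun h 2
  rw [fourierThree_zero, fourierThree_zero] at h0
  rw [fourierThree_one, fourierThree_one] at h1
  rw [fourierThree_two, fourierThree_two] at h2
  have h := cubeRoot_sq_add
  have h3 := cubeRoot_pow_three
  set w := cubeRoot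
  ext t
  fin_cases t
  · show u 0 = v 0
    linear_combination (h0 + h1 + h2 - (u 1 + u 2 - v 1 - v 2) * h) / 3
  · show u 1 = v 1
    grind
  · show u 2 = v 2
    grind

theorem conj_mul_fourierThree (u v : Fin 3 → ℂ) (j : Fin 3) :
    conj (fourierThree u j) * fourierThree v j =
      fourierThree (fun k => ∑ t, conj (u t) * v (t + k)) j := by
  have h3 := cubeRoot_pow_three
  have i11 : (1 + 1 : Fin 3) = 2 := rfl
  have i21 : (2 + 1 : Fin 3) = 0 := rfl
  have i12 : (1 + 2 : Fin 3) = 0 := rfl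
  have i22 : (2 + 2 : Fin 3) = 1 := rfl
  fin_cases j <;> simp only [Fin.zero_eta, Fin.mk_one, Fin.reduceFinMk, fourierThree_zero,
    fourierThree_one, fourierThree_two, map_add, map_mul, map_pow, conj_cubeRoot,
    Fin.sum_univ_three, i11, i21, i12, i22, zero_add, add_zero] <;>
  · generalize conj (u 0) = x0, conj (u 1) = x1, conj (u 2) = x2, cubeRoot = w at *
    clear i11 i21 i12 i22
    grind

/-- The autocorrelation of a Fourier transform is the transform of `|p|²`, here a constant, which
vanishes at a nonzero frequency. -/
theorem fourierThree_cyclic_sum (p : Fin 3 → ℂ) (hp : ∀ t, conj (p t) * p t = 1) :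
    fourierThree p 0 * conj (fourierThree p 1) + fourierThree p 1 * conj (fourierThree p 2) +
      fourierThree p 2 * conj (fourierThree p 0) = 0 := by
  have h := cubeRoot_sq_add
  have h3 := cubeRoot_pow_three
  have key : fourierThree p 0 * conj (fourierThree p 1) + fourierThree p 1 *
      conj (fourierThree p 2) + fourierThree p 2 * conj (fourierThree p 0) =
      3 * (conj (p 0) * p 0 + cubeRoot ^ 2 * (conj (p 1) * p 1) +
        cubeRoot * (conj (p 2) * p 2)) := by
    clear hp
    simp only [fourierThree_zero,
      fourierThree_one, fourierThree_two, map_add, map_mul, map_pow, conj_cubeRoot]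
    generalize conj (p 0) = x0, conj (p 1) = x1, conj (p 2) = x2, cubeRoot = w at *
    grind
  rw [key, hp, hp, hp]
  linear_combination 3 * h

theorem fourierThree_add (u v : Fin 3 → ℂ) (j : Fin 3) :
    fourierThree u j + fourierThree v j = fourierThree (u + v) j := by
  fin_cases j <;> simp only [Fin.zero_eta, Fin.mk_one, Fin.reduceFinMk, fourierThree_zero,
    fourierThree_one, fourierThree_two, Pi.add_apply] <;> ring

theorem fourierThree_single (z : ℂ) (j : Fin 3) : fourierThree ![z, 0, 0] j = z := by
  fin_cases j <;> simp [fourierThree]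

namespace CyclicSixRoot

open SpectralPair

theorem spectralPair {u v : Fin 3 → ℂ} (h : CyclicSixRoot u v) :
    SpectralPair (fourierThree u) (fourierThree v) := by
  have hu : ∀ t, conj (u t) * u t = 1 := fun t => by
    rw [mul_comm, mul_conj, h.normSq_left]; simp
  have hv : ∀ t, conj (v t) * v t = 1 := fun t => by
    rw [mul_comm, mul_conj, h.normSq_right]; simp
  have hnorm : ∀ j, conj (fourierThree u j) * fourierThree u j +
      conj (fourierThree v j) * fourierThree v j = 6 := by
    intro j
    rw [conj_mul_fourierThree, conj_mul_fourierThree, fourierThree_add, ← fourierThree_single 6 j]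
    congr 1
    ext k
    fin_cases k
    · simp [hu, hv]
      norm_num
    · have := h.even
      simpa [Finset.sum_add_distrib] using this
    -- The correlation at shift 2 is the conjugate of the one at shift 1.
    · have := congrArg conj h.even
      have i11 : (1 + 1 : Fin 3) = 2 := rfl
      have i21 : (2 + 1 : Fin 3) = 0 := rfl
      have i12 : (1 + 2 : Fin 3) = 0 := rfl
      have i22 : (2 + 2 : Fin 3) = 1 := rfl
      simp [Fin.sum_univ_three, i11, i21] at this
      simp [Fin.sum_univ_three, i12, i22]
      linear_combination this
  have hre : ∀ j, conj (fourierThree u j) * fourierThree v j +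
      conj (fourierThree v j) * fourierThree u j = 0 := by
    intro j
    rw [conj_mul_fourierThree, conj_mul_fourierThree, fourierThree_add]
    have : ((fun k => ∑ t, conj (u t) * v (t + k)) + fun k => ∑ t, conj (v t) * u (t + k)) =
        ![0, 0, 0] := by
      ext k
      rw [Pi.add_apply, ← Finset.sum_add_distrib, h.odd k]
      fin_cases k <;> rfl
    rw [this, fourierThree_single]
  refine ⟨fun j => ?_, fun j => ?_, fourierThree_cyclic_sum u hu,
    fourierThree_cyclic_sum v hv, ?_⟩
  · have := hnorm j
    rw [mul_comm, mul_conj, mul_comm, mul_conj] at this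
    exact_mod_cast this
  · have h1 := congrArg re (hre j)
    simp at h1 ⊢
    linarith
  · have h1 := conj_fourierThree_mul u u
    simp only [Fin.sum_univ_three, hu] at h1
    rw [mul_comm, mul_conj, mul_comm (conj _), mul_conj, mul_comm (conj _), mul_conj] at h1
    norm_num at h1
    exact_mod_cast h1

theorem normSq_pairing {u v u' v' : Fin 3 → ℂ}
    (h6 : normSq (∑ t, (conj (u t) * u' t + conj (v t) * v' t)) = 6) :
    normSq (pairing (fourierThree u) (fourierThree v) (fourierThree u') (fourierThree v')) = 54 := by
  have : pairing (fourierThree u) (fourierThree v) (fourierThree u') (fourierThree v') =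
      ((3 : ℝ) : ℂ) * ∑ t, (conj (u t) * u' t + conj (v t) * v' t) := by
    rw [pairing, Finset.sum_add_distrib, conj_fourierThree_mul, conj_fourierThree_mul,
      Finset.sum_add_distrib]
    push_cast
    ring
  rw [this, normSq_mul, h6, normSq_ofReal]
  norm_num

/-- One real vector fixes the same sign for every flat one, so `v i = ± I • u i` with a common sign.
All terms of `horth` are then equal and nonzero. -/
theorem false_of_flat_of_real {ι : Type*} [Fintype ι] [Nonempty ι] {u v : ι → Fin 3 → ℂ}
    (h : ∀ i, CyclicSixRoot (u i) (v i)) {u' v' : Fin 3 → ℂ} (h' : CyclicSixRoot u' v')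
    (h6 : ∀ i, normSq (∑ t, (conj (u i t) * u' t + conj (v i t) * v' t)) = 6)
    (horth : ∑ i, conj (u i 0) * v i 0 = 0)
    (hflat : ∀ i, ∃ s, IsFlat s (fourierThree (u i)) (fourierThree (v i)))
    (hreal : ∃ e z x y, IsReal e z x y (fourierThree u') (fourierThree v')) : False := by
  obtain ⟨e, z, x, y, hr⟩ := hreal
  obtain ⟨ε, δ, π, hε, hδ, hπ⟩ := hr.exists_profile h'.spectralPair
  have key : ∀ i, conj (u i 0) * v i 0 = ((ε * δ : ℝ) : ℂ) * I := by
    intro i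
    obtain ⟨s, hs⟩ := hflat i
    have hs' := hs.eq_of_normSq_pairing (h i).spectralPair hr hε hδ hπ (normSq_pairing (h6 i))
    have hv : v i = fun t => ((ε * δ : ℝ) : ℂ) * I * u i t := by
      apply fourierThree_injective
      ext j
      rw [hs.2 j, hs']
      fin_cases j <;> simp only [Fin.zero_eta, Fin.mk_one, Fin.reduceFinMk, fourierThree_zero,
        fourierThree_one, fourierThree_two] <;> ring
    have h1 : conj (u i 0) * u i 0 = 1 := by
      rw [mul_comm, mul_conj, (h i).normSq_left]; simp
    rw [hv]
    linear_combination ((ε * δ : ℝ) : ℂ) * I * h1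
  rw [Finset.sum_congr rfl (fun i _ => key i)] at horth
  have hεδ : (ε * δ) ^ 2 = 1 := by rw [mul_pow, hε, hδ, one_mul]
  have : ε * δ ≠ 0 := by rintro h0; rw [h0] at hεδ; norm_num at hεδ
  simp at horth
  rcases horth with h0 | h0
  · rw [h0] at this; simp at this
  · rw [h0] at this; simp at this

theorem false_of_unbiased {ι : Type*} [Fintype ι] [Nonempty ι] {u v u' v' : ι → Fin 3 → ℂ}
    (h : ∀ i, CyclicSixRoot (u i) (v i)) (h' : ∀ i, CyclicSixRoot (u' i) (v' i))
    (h6 : ∀ i j, normSq (∑ t, (conj (u i t) * u' j t + conj (v i t) * v' j t)) = 6)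
    (horth : ∑ i, conj (u i 0) * v i 0 = 0) (horth' : ∑ i, conj (u' i 0) * v' i 0 = 0) :
    False := by
  have h6' : ∀ j i, normSq (∑ t, (conj (u' j t) * u i t + conj (v' j t) * v i t)) = 6 := by
    intro j i
    rw [← h6 i j, ← normSq_conj, map_sum]
    congr 1
    refine Finset.sum_congr rfl fun t _ => ?_
    simp only [map_add, map_mul, conj_conj]
    ring
  by_cases hA : ∀ i, ∃ s, IsFlat s (fourierThree (u i)) (fourierThree (v i))
  · obtain ⟨i⟩ := ‹Nonempty ι›
    refine false_of_flat_of_real h (h' i) (fun j => h6 j i) horth hA ?_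
    refine (h' i).spectralPair.isFlat_or_isReal.resolve_left ?_
    rintro ⟨s, hs⟩
    obtain ⟨s', hs'⟩ := hA i
    exact hs'.normSq_pairing_ne (h i).spectralPair (h' i).spectralPair hs
      (normSq_pairing (h6 i i))
  · push Not at hA
    obtain ⟨i, hi⟩ := hA
    have hr : ∃ e z x y, IsReal e z x y (fourierThree (u i)) (fourierThree (v i)) :=
      (h i).spectralPair.isFlat_or_isReal.resolve_left fun ⟨s, hs⟩ => hi s hs
    refine false_of_flat_of_real h' (h i) (fun j => h6' j i) horth' (fun j => ?_) hr
    refine (h' j).spectralPair.isFlat_or_isReal.resolve_right ?_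
    rintro ⟨e, z, x, y, hj⟩
    obtain ⟨e', z', x', y', hi⟩ := hr
    exact hi.normSq_pairing_ne (h i).spectralPair (h' j).spectralPair hj
      (normSq_pairing (h6 i j))

end CyclicSixRoot

/-! ### Eisenstein integers and sums of cube roots of unity. -/

theorem exists_int_of_pow_three_eq_one {z : ℂ} (hz : z ^ 3 = 1) :
    ∃ a b : ℤ, z = a + b * cubeRoot := by
  have h := cubeRoot_sq_add
  have hprod : (z - 1) * ((z - cubeRoot) * (z + 1 + cubeRoot)) = 0 := by
    linear_combination hz - (z - 1) * h
  rcases mul_eq_zero.1 hprod with h1 | h1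
  · exact ⟨1, 0, by push_cast; linear_combination h1⟩
  rcases mul_eq_zero.1 h1 with h1 | h1
  · exact ⟨0, 1, by push_cast; linear_combination h1⟩
  · exact ⟨-1, -1, by push_cast; linear_combination h1⟩

/-- The norm `a² - a b + b²` is even only when `a` and `b` are both even, so it is never 2 modulo 4.
-/
theorem normSq_int_add_int_mul_cubeRoot_ne (a b : ℤ) : normSq (a + b * cubeRoot) ≠ 6 := by
  have h3 : (√3 : ℝ) ^ 2 = 3 := Real.sq_sqrt (by norm_num)
  intro h
  have h1 : ((a ^ 2 - a * b + b ^ 2 : ℤ) : ℝ) = (6 : ℤ) := by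
    push_cast
    rw [← h, normSq_apply]
    simp [cubeRoot]
    linear_combination -(b : ℝ) ^ 2 / 4 * h3
  have h2 : a ^ 2 - a * b + b ^ 2 = 6 := by exact_mod_cast h1
  have h4 := congrArg (Int.cast : ℤ → ZMod 4) h2
  push_cast at h4
  revert h4
  generalize (a : ZMod 4) = x
  generalize (b : ZMod 4) = y
  revert x y
  decide

/-- The two groups of three are the sums over two complementary triangles, and `g`, `ε g` are the
terms at the ends of an edge joining them. -/
theorem normSq_sum_ne_of_cube_roots {g ε z₁ z₂ z₃ z₄ : ℂ} {n : ℝ} (hn : n ≠ 0) (hg : normSq g = n)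
    (hε : ε = 1 ∨ ε = -1) (h₁ : z₁ ^ 3 = 1) (h₂ : z₂ ^ 3 = 1) (h₃ : z₃ ^ 3 = 1) (h₄ : z₄ ^ 3 = 1) :
    normSq (g + z₁ * g + z₂ * g + (ε * g + z₃ * (ε * g) + z₄ * (ε * g))) ≠ 6 * n := by
  obtain ⟨a₁, b₁, e₁⟩ := exists_int_of_pow_three_eq_one h₁
  obtain ⟨a₂, b₂, e₂⟩ := exists_int_of_pow_three_eq_one h₂
  obtain ⟨a₃, b₃, e₃⟩ := exists_int_of_pow_three_eq_one h₃
  obtain ⟨a₄, b₄, e₄⟩ := exists_int_of_pow_three_eq_one h₄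
  intro h
  have key : ∀ a b : ℤ, g + z₁ * g + z₂ * g + (ε * g + z₃ * (ε * g) + z₄ * (ε * g)) =
      (a + b * cubeRoot) * g → False := by
    intro a b e
    rw [e, normSq_mul, hg] at h
    exact normSq_int_add_int_mul_cubeRoot_ne a b (mul_right_cancel₀ hn h)
  rcases hε with rfl | rfl
  · refine key (1 + a₁ + a₂ + (1 + a₃ + a₄)) (b₁ + b₂ + (b₃ + b₄)) ?_
    rw [e₁, e₂, e₃, e₄]; push_cast; ring
  · refine key (1 + a₁ + a₂ - (1 + a₃ + a₄)) (b₁ + b₂ - (b₃ + b₄)) ?_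
    rw [e₁, e₂, e₃, e₄]; push_cast; ring

theorem exists_cube_root_of_sum_eq_zero {h₀ h₁ h₂ : ℂ} (n₀ : normSq h₀ = 1) (n₁ : normSq h₁ = 1)
    (n₂ : normSq h₂ = 1) (h : h₀ + h₁ + h₂ = 0) :
    ∃ z : ℂ, z ^ 2 + z + 1 = 0 ∧ h₁ = h₀ * z ∧ h₂ = h₀ * z ^ 2 := by
  have c₀ : h₀ * conj h₀ = 1 := by rw [mul_conj, n₀]; simp
  have c₁ : h₁ * conj h₁ = 1 := by rw [mul_conj, n₁]; simp
  have c₂ : h₂ * conj h₂ = 1 := by rw [mul_conj, n₂]; simp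
  have hc := congrArg conj h
  simp only [map_add, map_zero] at hc
  have e : h₁ * h₂ + h₂ * h₀ + h₀ * h₁ = 0 := by
    linear_combination h₀ * h₁ * h₂ * hc - h₁ * h₂ * c₀ - h₂ * h₀ * c₁ - h₀ * h₁ * c₂
  have e2 : h₁ ^ 2 + h₁ * h₀ + h₀ ^ 2 = 0 := by
    linear_combination (h₀ + h₁) * h - e
  refine ⟨h₁ * conj h₀, ?_, ?_, ?_⟩
  · linear_combination (conj h₀) ^ 2 * e2 - (h₁ * conj h₀ + h₀ * conj h₀ + 1) * c₀
  · linear_combination -h₁ * c₀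
  · have : h₂ = -h₀ - h₁ := by linear_combination h
    rw [this]
    linear_combination -conj h₀ * e2 + (h₁ + h₀ - h₁ ^ 2 * conj h₀) * c₀

/-- Let `A` be the cyclic sum. Expanding the two squared moduli gives `Re A = 0` and `Re (z A) = 0`
for a primitive cube root of unity `z`; as `z` is not real, `A = 0`. -/
theorem cyclic_sum_eq_zero {n : ℝ} {f₀ f₁ f₂ h₀ h₁ h₂ : ℂ}
    (hf₀ : normSq f₀ = n) (hf₁ : normSq f₁ = n) (hf₂ : normSq f₂ = n)
    (hh₀ : normSq h₀ = 1) (hh₁ : normSq h₁ = 1) (hh₂ : normSq h₂ = 1)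
    (hh : h₀ + h₁ + h₂ = 0)
    (e₀ : normSq (f₀ + f₁ + f₂) = 3 * n)
    (e₁ : normSq (conj h₀ * f₀ + conj h₁ * f₁ + conj h₂ * f₂) = 3 * n) :
    f₀ * conj f₁ + f₁ * conj f₂ + f₂ * conj f₀ = 0 := by
  obtain ⟨z, hz, rfl, rfl⟩ := exists_cube_root_of_sum_eq_zero hh₀ hh₁ hh₂ hh
  have hz3 : z ^ 3 = 1 := by linear_combination (z - 1) * hz
  set A := f₀ * conj f₁ + f₁ * conj f₂ + f₂ * conj f₀ with hA
  have expand : ∀ w : ℂ, w ^ 3 = 1 → ∀ u : ℂ, normSq u = 1 →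
      normSq (conj u * f₀ + conj (u * w) * f₁ + conj (u * w ^ 2) * f₂) = 3 * n → (w * A).re = 0 := by
    intro w hw u hu hs
    have hwc := conj_of_pow_three_eq_one hw
    have e : conj u * f₀ + conj (u * w) * f₁ + conj (u * w ^ 2) * f₂ =
        conj u * (f₀ + w ^ 2 * f₁ + w * f₂) := by
      simp only [map_mul, map_pow, hwc]
      linear_combination conj u * f₂ * w * hw
    rw [e, normSq_mul, normSq_conj, hu, one_mul] at hs
    have cf₀ : f₀ * conj f₀ = n := by rw [mul_conj, hf₀]
    have cf₁ : f₁ * conj f₁ = n := by rw [mul_conj, hf₁]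
    have cf₂ : f₂ * conj f₂ = n := by rw [mul_conj, hf₂]
    have hs' : (f₀ + w ^ 2 * f₁ + w * f₂) * conj (f₀ + w ^ 2 * f₁ + w * f₂) = 3 * n := by
      rw [mul_conj, hs]; push_cast; rfl
    have e3 : w * A + conj (w * A) = 0 := by
      simp only [hA, map_add, map_mul, map_pow, hwc, conj_conj] at hs' ⊢
      linear_combination hs' - cf₀ - cf₁ - cf₂
        - (f₁ * conj f₁ * (w ^ 3 + 1) + f₂ * conj f₂ + w * f₁ * conj f₂ + f₂ * conj f₁ * w ^ 2 + w * f₀ * conj f₁) * hw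
    have := congrArg re e3
    simp only [add_re, conj_re, zero_re] at this
    linarith
  have r₀ := expand 1 (by simp) 1 (by simp) (by simpa using e₀)
  have r₁ := expand z hz3 h₀ hh₀ e₁
  rw [one_mul] at r₀
  have hzr : (z * A).re = z.re * A.re - z.im * A.im := mul_re _ _
  rcases re_of_pow_three_eq_one hz3 with ⟨q1, q2⟩ | ⟨q1, q2⟩
  · have : z = 1 := Complex.ext (by simpa using q1) (by simpa using q2)
    rw [this] at hz
    norm_num at hz
  · have hi : z.im ≠ 0 := by
      intro h0
      rw [h0] at q2
      norm_num at q2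
    apply Complex.ext
    · exact r₀
    · rw [r₁, r₀, mul_zero, zero_sub] at hzr
      have : z.im * A.im = 0 := by linarith
      exact (mul_eq_zero.1 this).resolve_left hi

/-! ### Commuting transitive permutations of six points. -/

/-- A commuting set of permutations of `Fin 6` that is transitive acts as `ℤ/2 × ℤ/3`. -/
theorem exists_coordinates (S : Set (Equiv.Perm (Fin 6))) (hcomm : ∀ σ ∈ S, ∀ τ ∈ S, σ * τ = τ * σ)
    (htrans : ∀ p q, ∃ σ ∈ S, σ p = q) :
    ∃ φ : Fin 2 × Fin 3 ≃ Fin 6, ∀ a, ∃ σ ∈ S, ∀ x, σ (φ x) = φ (x + a) := by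
  -- The centralizer of a transitive set acts freely. As `S` commutes, it lies in `K`, and freeness
  -- gives `K = S`: a regular abelian group of order 6, generated by elements of orders 2 and 3.
  set K := Subgroup.centralizer S
  have hmem : ∀ {k}, k ∈ K ↔ ∀ σ ∈ S, σ * k = k * σ := Subgroup.mem_centralizer_iff
  have hSK : ∀ σ ∈ S, σ ∈ K := fun σ hσ => hmem.2 fun τ hτ => hcomm τ hτ σ hσ
  have hfree : ∀ k ∈ K, ∀ p, k p = p → k = 1 := by
    intro k hk p hp
    ext q
    obtain ⟨σ, hσ, rfl⟩ := htrans p q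
    have := congrArg (fun f : Equiv.Perm (Fin 6) => f p) (hmem.1 hk σ hσ)
    simp only [Equiv.Perm.mul_apply, hp] at this
    simp [← this]
  have hKS : ∀ k ∈ K, k ∈ S := by
    intro k hk
    obtain ⟨σ, hσ, h⟩ := htrans 0 (k 0)
    have : σ⁻¹ * k = 1 := hfree _ (K.mul_mem (K.inv_mem (hSK σ hσ)) hk) 0 (by
      show σ.symm (k 0) = 0
      rw [← h, Equiv.symm_apply_apply])
    rwa [← inv_mul_eq_one.1 this]
  have hcard : Nat.card K = 6 := by
    have hb : Function.Bijective (fun k : K => (k : Equiv.Perm (Fin 6)) 0) := by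
      constructor
      · intro k l h
        have : (l : Equiv.Perm (Fin 6))⁻¹ * k = 1 := hfree _ (K.mul_mem (K.inv_mem l.2) k.2) 0 (by
          show (l : Equiv.Perm (Fin 6)).symm ((k : Equiv.Perm (Fin 6)) 0) = 0
          simp only at h
          rw [h, Equiv.symm_apply_apply])
        exact Subtype.ext (inv_mul_eq_one.1 this).symm
      · intro q
        obtain ⟨σ, hσ, h⟩ := htrans 0 q
        exact ⟨⟨σ, hSK σ hσ⟩, h⟩
    rw [Nat.card_eq_of_bijective _ hb, Nat.card_eq_fintype_card, Fintype.card_fin]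
  obtain ⟨⟨t, htK⟩, ht⟩ := exists_prime_orderOf_dvd_card' (G := K) 2 (by rw [hcard]; norm_num)
  obtain ⟨⟨s, hsK⟩, hs⟩ := exists_prime_orderOf_dvd_card' (G := K) 3 (by rw [hcard]; norm_num)
  rw [Subgroup.orderOf_mk] at ht hs
  have hts : Commute t s := hcomm t (hKS t htK) s (hKS s hsK)
  have t2 : t ^ 2 = 1 := ht ▸ pow_orderOf_eq_one t
  have s3 : s ^ 3 = 1 := hs ▸ pow_orderOf_eq_one s
  set g : Fin 2 × Fin 3 → Equiv.Perm (Fin 6) := fun x => t ^ (x.1 : ℕ) * s ^ (x.2 : ℕ) with hg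
  have hgK : ∀ x, g x ∈ K := fun x => K.mul_mem (K.pow_mem htK _) (K.pow_mem hsK _)
  have hadd : ∀ x a, g (x + a) = g a * g x := by
    intro x a
    have h1 : t ^ ((x.1 + a.1 : Fin 2) : ℕ) = t ^ (a.1 : ℕ) * t ^ (x.1 : ℕ) := by
      have := pow_mod_orderOf t (x.1 + a.1)
      rw [ht] at this
      rw [Fin.val_add, this, ← pow_add, add_comm]
    have h2 : s ^ ((x.2 + a.2 : Fin 3) : ℕ) = s ^ (a.2 : ℕ) * s ^ (x.2 : ℕ) := by
      have := pow_mod_orderOf s (x.2 + a.2)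
      rw [hs] at this
      rw [Fin.val_add, this, ← pow_add, add_comm]
    simp only [hg, Prod.fst_add, Prod.snd_add, h1, h2]
    have := (hts.pow_pow (x.1 : ℕ) (a.2 : ℕ)).eq
    rw [mul_assoc, ← mul_assoc (t ^ (x.1 : ℕ)), this]
    simp only [mul_assoc]
  have hinj : Function.Injective g := by
    intro x y h
    have h1 : t ^ (x.1 : ℕ) = t ^ (y.1 : ℕ) := by
      -- Cubing removes the power of `s` and fixes that of `t`.
      have h3 := congrArg (· ^ 3) h
      simp only [hg] at h3
      rw [(hts.pow_pow _ _).mul_pow, (hts.pow_pow _ _).mul_pow, ← pow_mul, ← pow_mul,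
        ← pow_mul, ← pow_mul, mul_comm (x.2 : ℕ), mul_comm (y.2 : ℕ), pow_mul s, pow_mul s, s3,
        one_pow, one_pow, mul_one, mul_one, mul_comm (x.1 : ℕ), mul_comm (y.1 : ℕ), pow_mul,
        pow_mul t] at h3
      have : t ^ 3 = t := by rw [pow_succ, t2, one_mul]
      rwa [this] at h3
    have h2 : s ^ (x.2 : ℕ) = s ^ (y.2 : ℕ) := by
      simp only [hg] at h
      rw [h1] at h
      exact mul_left_cancel h
    refine Prod.ext (Fin.ext ?_) (Fin.ext ?_)
    · exact pow_injOn_Iio_orderOf (by rw [Set.mem_Iio, ht]; exact x.1.2)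
        (by rw [Set.mem_Iio, ht]; exact y.1.2) h1
    · exact pow_injOn_Iio_orderOf (by rw [Set.mem_Iio, hs]; exact x.2.2)
        (by rw [Set.mem_Iio, hs]; exact y.2.2) h2
  have hφ : Function.Bijective (fun x => g x 0) := by
    rw [Fintype.bijective_iff_injective_and_card]
    refine ⟨fun x y h => hinj ?_, by simp⟩
    have : (g y)⁻¹ * g x = 1 := hfree _ (K.mul_mem (K.inv_mem (hgK y)) (hgK x)) 0 (by
      show (g y).symm (g x 0) = 0
      simp only at h
      rw [h, Equiv.symm_apply_apply])
    exact (inv_mul_eq_one.1 this).symm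
  refine ⟨Equiv.ofBijective _ hφ, fun a => ⟨g a, hKS _ (hgK a), fun x => ?_⟩⟩
  simp only [Equiv.ofBijective_apply, hadd, Equiv.Perm.mul_apply]

/-! ### Eigenbases of monomial classes. -/

namespace IsMonomialMatrix

variable {n : ℕ} {A : Matrix (Fin n) (Fin n) ℂ}

/-- The permutation that underlies a monomial matrix. -/
theorem exists_perm (hA : IsMonomialMatrix A) :
    ∃ σ : Equiv.Perm (Fin n), ∀ p q, A p q ≠ 0 ↔ q = σ p := by
  choose r hr hr' using hA.1
  choose s hs hs' using hA.2
  refine ⟨⟨r, s, fun p => (hs' _ p (hr p)).symm, fun q => (hr' _ q (hs q)).symm⟩, fun p q => ?_⟩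
  constructor
  · exact fun h => hr' p q h
  · rintro rfl
    exact hr p

theorem mulVec_apply (hA : IsMonomialMatrix A) {p q : Fin n} (h : A p q ≠ 0) (x : Fin n → ℂ) :
    A.mulVec x p = A p q * x q := by
  rw [Matrix.mulVec, dotProduct]
  apply Finset.sum_eq_single q
  · intro r _ hr
    by_contra h0
    exact hr ((hA.1 p).unique (left_ne_zero_of_mul h0) h)
  · simp

end IsMonomialMatrix

/-- The rows of `v` form an orthonormal basis. -/
structure IsUnitaryFrame {n : ℕ} (v : Fin n → Fin n → ℂ) : Prop where
  inner_vectors : ∀ i j, ∑ p, conj (v i p) * v j p = if i = j then 1 else 0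
  inner_coordinates : ∀ p q, ∑ i, v i p * conj (v i q) = if p = q then 1 else 0

/-- The vectors `v i` are an orthonormal eigenbasis of the matrices `A` in a maximal commuting
class, with eigenvalues `c A i`. -/
structure IsEigenframe {n : ℕ} (C : Finset (Matrix (Fin n) (Fin n) ℂ)) (v : Fin n → Fin n → ℂ)
    (c : Matrix (Fin n) (Fin n) ℂ → Fin n → ℂ) : Prop extends IsUnitaryFrame v where
  isClass : IsMaximalCommutingClass C
  mulVec : ∀ A ∈ C, ∀ i, A.mulVec (v i) = c A i • v i

namespace IsEigenframe

variable {n : ℕ} {C : Finset (Matrix (Fin n) (Fin n) ℂ)} {v : Fin n → Fin n → ℂ}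
  {c : Matrix (Fin n) (Fin n) ℂ → Fin n → ℂ} {A : Matrix (Fin n) (Fin n) ℂ}

theorem apply_eq (h : IsEigenframe C v c) (hA : A ∈ C) (p q : Fin n) :
    A p q = ∑ i, c A i * v i p * conj (v i q) := by
  have h1 : ∀ i, c A i * v i p = ∑ r, A p r * v i r := fun i => by
    have := congrFun (h.mulVec A hA i) p
    simpa [Matrix.mulVec, dotProduct] using this.symm
  simp only [h1, Finset.sum_mul]
  rw [Finset.sum_comm]
  simp only [mul_assoc, ← Finset.mul_sum, h.inner_coordinates]
  simp

theorem sum_conj_mul_mul (h : IsEigenframe C v c) (hA : A ∈ C) (w : Fin n → ℂ) :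
    ∑ p, ∑ q, conj (w p) * A p q * w q =
      ∑ i, c A i * (normSq (∑ p, conj (v i p) * w p) : ℂ) := by
  have h1 : ∀ i, (normSq (∑ p, conj (v i p) * w p) : ℂ) =
      ∑ p, ∑ q, conj (w p) * v i p * (conj (v i q) * w q) := by
    intro i
    rw [← mul_conj, mul_comm, map_sum, Finset.sum_mul_sum]
    simp only [map_mul, conj_conj, mul_comm (v i _)]
  simp only [h1, h.apply_eq hA, Finset.mul_sum, Finset.sum_mul]
  rw [Finset.sum_comm (s := Finset.univ (α := Fin n)) (f := fun i p =>
    ∑ q, c A i * (conj (w p) * v i p * (conj (v i q) * w q)))]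
  refine Finset.sum_congr rfl fun p _ => ?_
  rw [Finset.sum_comm]
  refine Finset.sum_congr rfl fun i _ => Finset.sum_congr rfl fun q _ => ?_
  ring

theorem normSq_eigenvalue (h : IsEigenframe C v c) (hA : A ∈ C) (i : Fin n) :
    normSq (c A i) = 1 := by
  have h1 : star (A.mulVec (v i)) ⬝ᵥ A.mulVec (v i) = star (v i) ⬝ᵥ v i := by
    have hu := Matrix.mem_unitaryGroup_iff'.1 (h.isClass.unitary A hA)
    rw [Matrix.star_mulVec, ← Matrix.dotProduct_mulVec, Matrix.mulVec_mulVec,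
      ← Matrix.star_eq_conjTranspose, hu, Matrix.one_mulVec]
  have h2 : star (v i) ⬝ᵥ v i = 1 := by
    have := h.inner_vectors i i
    simpa [dotProduct] using this
  rw [h.mulVec A hA, star_smul, smul_dotProduct, dotProduct_smul, h2] at h1
  simp only [smul_eq_mul, mul_one] at h1
  have h3 : ((normSq (c A i) : ℝ) : ℂ) = 1 := by
    rw [← mul_conj, mul_comm]
    exact h1
  exact_mod_cast h3

theorem trace_conjTranspose_mul (h : IsEigenframe C v c) {B : Matrix (Fin n) (Fin n) ℂ}
    (hA : A ∈ C) (hB : B ∈ C) :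
    (A.conjTranspose * B).trace = ∑ i, conj (c A i) * c B i := by
  have key : ∀ q, (A.conjTranspose * B) q q =
      ∑ i, conj (c A i) * c B i * (v i q * conj (v i q)) := by
    intro q
    rw [Matrix.mul_apply]
    have e1 : ∀ p, A.conjTranspose q p * B p q = ∑ i, ∑ j,
        conj (c A i) * v i q * c B j * conj (v j q) * (conj (v i p) * v j p) := by
      intro p
      rw [Matrix.conjTranspose_apply, h.apply_eq hA, h.apply_eq hB, star_sum, Finset.sum_mul_sum]
      refine Finset.sum_congr rfl fun i _ => Finset.sum_congr rfl fun j _ => ?_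
      simp only [star_def, map_mul, conj_conj]
      ring
    simp only [e1]
    rw [Finset.sum_comm]
    refine Finset.sum_congr rfl fun i _ => ?_
    rw [Finset.sum_comm]
    simp only [← Finset.mul_sum, h.inner_vectors]
    simp
    ring
  rw [Matrix.trace]
  simp only [Matrix.diag_apply, key]
  rw [Finset.sum_comm]
  simp only [← Finset.mul_sum]
  refine Finset.sum_congr rfl fun i _ => ?_
  have := h.inner_vectors i i
  simp only [mul_comm (conj (v i _))] at this
  rw [this]
  simp

theorem sum_eigenvalues (h : IsEigenframe C v c) (hA : A ∈ C) (h1 : A ≠ 1) :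
    ∑ i, c A i = 0 := by
  have h2 := h.isClass.orthogonal 1 h.isClass.one_mem A hA h1.symm
  have h3 : ∀ i, v i ≠ 0 := by
    intro i h0
    have := h.inner_vectors i i
    simp [h0] at this
  have h4 : ∀ i, c 1 i = 1 := by
    intro i
    have := h.mulVec 1 h.isClass.one_mem i
    rw [Matrix.one_mulVec] at this
    have h5 : (c 1 i - 1) • v i = 0 := by rw [sub_smul, ← this, one_smul, sub_self]
    exact sub_eq_zero.1 ((smul_eq_zero.1 h5).resolve_right (h3 i))
  rw [h.trace_conjTranspose_mul h.isClass.one_mem hA] at h2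
  simpa [h4] using h2

/-- Trace orthogonality says that the rows of the eigenvalue table, indexed by `C`, are orthogonal.
The table is square because `C` has `n` members, so its columns are orthogonal as well. -/
theorem sum_conj_mul_eigenvalues (h : IsEigenframe C v c) (i j : Fin n) :
    ∑ A ∈ C, conj (c A i) * c A j = if i = j then (n : ℂ) else 0 := by
  have hn : (n : ℂ) ≠ 0 := by
    have := i.pos
    exact_mod_cast this.ne'
  let M : Matrix C (Fin n) ℂ := fun A i => c A i
  have hM : ∀ i A, M.conjTranspose i A = conj (c A i) := fun _ _ => rfl
  have e : C ≃ Fin n := Fintype.equivFinOfCardEq (by simp [h.isClass.card_eq])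
  have h1 : M * ((n : ℂ)⁻¹ • M.conjTranspose) = 1 := by
    ext A B
    rw [Matrix.mul_apply]
    have e1 : ∑ k, M A k * ((n : ℂ)⁻¹ • M.conjTranspose) k B =
        (n : ℂ)⁻¹ * ∑ k, conj (c B k) * c A k := by
      rw [Finset.mul_sum]
      refine Finset.sum_congr rfl fun k _ => ?_
      rw [Matrix.smul_apply, hM, smul_eq_mul]
      ring
    rw [e1]
    by_cases hAB : A = B
    · subst hAB
      have : ∀ k, conj (c A k) * c A k = 1 := fun k => by
        rw [mul_comm, mul_conj, h.normSq_eigenvalue A.2]; simp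
      simp [this, hn]
    · rw [← h.trace_conjTranspose_mul B.2 A.2, h.isClass.orthogonal B B.2 A A.2
        (fun hh => hAB (Subtype.ext hh.symm))]
      simp [hAB]
  have h2 := (Matrix.mul_eq_one_comm_of_equiv e).1 h1
  have h3 := congrFun (congrFun h2 i) j
  rw [Matrix.mul_apply] at h3
  simp only [Matrix.smul_apply, hM, smul_eq_mul, mul_assoc, ← Finset.mul_sum, Matrix.one_apply] at h3
  rw [← Finset.sum_coe_sort C (fun A => conj (c A i) * c A j)]
  rw [inv_mul_eq_iff_eq_mul₀ hn] at h3
  rw [h3]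
  simp

/-- Column orthogonality inverts the spectral decomposition: `∑ A, conj (c A i) A` is `n` times the
projection onto `v i`, whose entry at `p, q` is nonzero. -/
theorem exists_apply_ne_zero (h : IsEigenframe C v c) {i p q : Fin n} (hp : v i p ≠ 0)
    (hq : v i q ≠ 0) : ∃ A ∈ C, A p q ≠ 0 := by
  by_contra! h0
  have h1 : ∑ A ∈ C, conj (c A i) * A p q = n * (v i p * conj (v i q)) := by
    have e : ∀ A ∈ C, conj (c A i) * A p q =
        ∑ j, conj (c A i) * c A j * (v j p * conj (v j q)) := by
      intro A hA
      rw [h.apply_eq hA, Finset.mul_sum]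
      exact Finset.sum_congr rfl fun j _ => by ring
    rw [Finset.sum_congr rfl e, Finset.sum_comm]
    simp only [← Finset.sum_mul, h.sum_conj_mul_eigenvalues]
    simp
  rw [Finset.sum_eq_zero fun A hA => by rw [h0 A hA, mul_zero]] at h1
  have hn : (n : ℂ) ≠ 0 := by
    have := i.pos
    exact_mod_cast this.ne'
  have : conj (v i q) ≠ 0 := by simpa using hq
  exact mul_ne_zero hn (mul_ne_zero hp this) h1.symm

end IsEigenframe

theorem IsUnitaryFrame.sum_normSq_coordinate {n : ℕ} {v : Fin n → Fin n → ℂ}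
    (h : IsUnitaryFrame v) (p : Fin n) : ∑ i, normSq (v i p) = 1 := by
  have := h.inner_coordinates p p
  simp only [mul_conj, if_true] at this
  exact_mod_cast this

theorem IsUnitaryFrame.sum_normSq_vector {n : ℕ} {v : Fin n → Fin n → ℂ}
    (h : IsUnitaryFrame v) (i : Fin n) : ∑ p, normSq (v i p) = 1 := by
  have := h.inner_vectors i i
  simp only [mul_comm (conj _), mul_conj, if_true] at this
  exact_mod_cast this

/-- An orthonormal basis whose vectors are flat on their supports, which are pairwise equal or
disjoint. -/
structure IsBlockFrame {n : ℕ} (v : Fin n → Fin n → ℂ) : Prop extends IsUnitaryFrame v where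
  normSq_eq : ∀ i p q, v i p ≠ 0 → v i q ≠ 0 → normSq (v i p) = normSq (v i q)
  support : ∀ i j p q, v i p ≠ 0 → v j p ≠ 0 → v i q ≠ 0 → v j q ≠ 0

/-- All vectors of the frame have full support. -/
def IsFullFrame {n : ℕ} (v : Fin n → Fin n → ℂ) : Prop := ∀ i p, v i p ≠ 0

namespace IsEigenframe

section

variable {n : ℕ} {C : Finset (Matrix (Fin n) (Fin n) ℂ)} {v : Fin n → Fin n → ℂ}
  {c : Matrix (Fin n) (Fin n) ℂ → Fin n → ℂ} {A : Matrix (Fin n) (Fin n) ℂ}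

theorem apply_mul_eq (h : IsEigenframe C v c) (hA : A ∈ C) (hm : IsMonomialMatrix A)
    {p q : Fin n} (h0 : A p q ≠ 0) (i : Fin n) : A p q * v i q = c A i * v i p := by
  rw [← hm.mulVec_apply h0, h.mulVec A hA]
  rfl

/-- The eigenvalue equation gives `|A p q|² |v i q|² = |v i p|²` for every `i`; summing over `i`
gives `|A p q| = 1`. -/
theorem normSq_eq_of_apply_ne_zero (h : IsEigenframe C v c) (hA : A ∈ C)
    (hm : IsMonomialMatrix A) {p q : Fin n} (h0 : A p q ≠ 0) (i : Fin n) :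
    normSq (v i q) = normSq (v i p) := by
  have h1 : ∀ i, normSq (A p q) * normSq (v i q) = normSq (v i p) := fun i => by
    rw [← normSq_mul, h.apply_mul_eq hA hm h0, normSq_mul, h.normSq_eigenvalue hA, one_mul]
  have h2 : normSq (A p q) = 1 := by
    have := h.sum_normSq_coordinate p
    simpa only [← h1, ← Finset.mul_sum, h.sum_normSq_coordinate, mul_one] using this
  rw [← h1, h2, one_mul]

theorem isBlockFrame (h : IsEigenframe C v c) (hm : ∀ A ∈ C, IsMonomialMatrix A) :
    IsBlockFrame v where
  toIsUnitaryFrame := h.toIsUnitaryFrame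
  normSq_eq i p q hp hq := by
    obtain ⟨A, hA, h0⟩ := h.exists_apply_ne_zero hp hq
    exact (h.normSq_eq_of_apply_ne_zero hA (hm A hA) h0 i).symm
  support i j p q hip hjp hiq := by
    obtain ⟨A, hA, h0⟩ := h.exists_apply_ne_zero hip hiq
    have := h.normSq_eq_of_apply_ne_zero hA (hm A hA) h0 j
    intro hj
    rw [hj, map_zero] at this
    exact hjp (normSq_eq_zero.1 this.symm)

end

variable {C : Finset (Matrix (Fin 6) (Fin 6) ℂ)} {v : Fin 6 → Fin 6 → ℂ}
  {c : Matrix (Fin 6) (Fin 6) ℂ → Fin 6 → ℂ}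

/-- Full support makes the underlying permutations transitive. If `w` is unbiased to the frame, `⟨w,
A w⟩` is one sixth of the sum of the eigenvalues of `A`, hence 0 for `A ≠ 1`. The eigenvalue
equation of `v 0` expresses the entries of `A` through `v 0`, which turns `⟨w, A w⟩` into an
autocorrelation of `conj (v 0) * w`. -/
theorem exists_cyclicSixRoot (h : IsEigenframe C v c) (hm : ∀ A ∈ C, IsMonomialMatrix A)
    (hf : IsFullFrame v) :
    ∃ φ : Fin 2 × Fin 3 ≃ Fin 6, ∀ w : Fin 6 → ℂ, (∀ p, normSq (w p) = 1 / 6) →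
      (∀ i, normSq (∑ p, conj (v i p) * w p) = 1 / 6) →
      CyclicSixRoot (fun t => 6 * conj (v 0 (φ (0, t))) * w (φ (0, t)))
        (fun t => 6 * conj (v 0 (φ (1, t))) * w (φ (1, t))) := by
  have hv : ∀ p, normSq (v 0 p) = 1 / 6 := by
    intro p
    have h1 := h.sum_normSq_vector 0
    rw [Finset.sum_congr rfl fun q _ =>
      (h.isBlockFrame hm).normSq_eq 0 q p (hf 0 q) (hf 0 p)] at h1
    simp at h1
    linarith
  set S : Set (Equiv.Perm (Fin 6)) := {σ | ∃ A ∈ C, ∀ p q, A p q ≠ 0 ↔ q = σ p}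
  have hcomm : ∀ σ ∈ S, ∀ τ ∈ S, σ * τ = τ * σ := by
    have key : ∀ σ τ : Equiv.Perm (Fin 6), ∀ A B : Matrix (Fin 6) (Fin 6) ℂ,
        (∀ p q, A p q ≠ 0 ↔ q = σ p) → (∀ p q, B p q ≠ 0 ↔ q = τ p) →
        ∀ p q, (A * B) p q ≠ 0 ↔ q = τ (σ p) := by
      intro σ τ A B hA hB p q
      rw [Matrix.mul_apply, Finset.sum_eq_single (σ p)]
      · rw [mul_ne_zero_iff, hB]
        exact and_iff_right ((hA p (σ p)).2 rfl)
      · intro r _ hr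
        rw [not_ne_iff.1 (mt (hA p r).1 hr), zero_mul]
      · simp
    rintro σ ⟨A, hA, hσ⟩ τ ⟨B, hB, hτ⟩
    ext p
    have h1 := key σ τ A B hσ hτ p (τ (σ p))
    rw [(h.isClass.commute A hA B hB).eq, key τ σ B A hτ hσ] at h1
    simp only [iff_true] at h1
    simp [h1]
  have htrans : ∀ p q, ∃ σ ∈ S, σ p = q := by
    intro p q
    obtain ⟨A, hA, h0⟩ := h.exists_apply_ne_zero (hf 0 p) (hf 0 q)
    obtain ⟨σ, hσ⟩ := (hm A hA).exists_perm
    exact ⟨σ, ⟨A, hA, hσ⟩, ((hσ p q).1 h0).symm⟩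
  obtain ⟨φ, hφ⟩ := exists_coordinates S hcomm htrans
  refine ⟨φ, fun w hw hvw => ?_⟩
  set f : Fin 6 → ℂ := fun p => 6 * conj (v 0 p) * w p with hfdef
  have hfn : ∀ p, normSq (f p) = 1 := by
    intro p
    simp only [hfdef, normSq_mul, normSq_conj, hv, hw, normSq_ofNat]
    norm_num
  have hcor : ∀ a, a ≠ 0 → ∑ x, conj (f (φ x)) * f (φ (x + a)) = 0 := by
    intro a ha
    obtain ⟨σ, ⟨A, hA, hσ⟩, hσa⟩ := hφ a
    have hA1 : A ≠ 1 := by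
      rintro rfl
      have h1 := (hσ (φ 0) (φ 0)).1 (by simp)
      rw [hσa, zero_add] at h1
      exact ha (φ.injective h1).symm
    have h1 := h.sum_conj_mul_mul hA w
    simp only [hvw, ← Finset.sum_mul, h.sum_eigenvalues hA hA1, zero_mul] at h1
    have h2 : ∀ p, ∑ q, conj (w p) * A p q * w q =
        c A 0 / 6 * (conj (f p) * f (σ p)) := by
      intro p
      rw [Finset.sum_eq_single (σ p)]
      · have h3 := h.apply_mul_eq hA (hm A hA) ((hσ p (σ p)).2 rfl) 0
        have h4 : v 0 (σ p) * conj (v 0 (σ p)) = 1 / 6 := by rw [mul_conj, hv]; norm_num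
        simp only [hfdef, map_mul, conj_conj, map_ofNat]
        linear_combination 6 * conj (w p) * w (σ p) * conj (v 0 (σ p)) * h3
          - 6 * conj (w p) * w (σ p) * A p (σ p) * h4
      · intro q _ hq
        rw [not_ne_iff.1 (mt (hσ p q).1 hq)]
        ring
      · simp
    simp only [h2, ← Finset.mul_sum] at h1
    have h3 : c A 0 / 6 ≠ 0 := by
      have := h.normSq_eigenvalue hA 0
      intro h0
      have : c A 0 = 0 := by simpa using h0
      simp [this] at *
    rw [← (mul_eq_zero.1 h1).resolve_left h3, ← Equiv.sum_comp φ]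
    simp only [hσa]
  change CyclicSixRoot (fun t => f (φ (0, t))) (fun t => f (φ (1, t)))
  refine ⟨fun t => hfn _, fun t => hfn _, ?_, fun k => ?_⟩
  · have := hcor (0, 1) (by simp)
    rw [Fintype.sum_prod_type, Fin.sum_univ_two, ← Finset.sum_add_distrib] at this
    simpa using this
  · have := hcor (1, k) (by simp)
    rw [Fintype.sum_prod_type, Fin.sum_univ_two, ← Finset.sum_add_distrib] at this
    simpa using this

end IsEigenframe

/-! ### Block frames: sizes of supports, and phases on edges and triangles. -/

theorem IsUnitaryFrame.parseval {n : ℕ} {v : Fin n → Fin n → ℂ}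
    (h : IsUnitaryFrame v) (x : Fin n → ℂ) :
    ∑ i, normSq (∑ p, conj (v i p) * x p) = ∑ p, normSq (x p) := by
  have key : ∑ i, (∑ p, conj (v i p) * x p) * conj (∑ p, conj (v i p) * x p) =
      ∑ p, x p * conj (x p) := by
    have e : ∀ i, (∑ p, conj (v i p) * x p) * conj (∑ p, conj (v i p) * x p) =
        ∑ p, ∑ q, x p * conj (x q) * (v i q * conj (v i p)) := by
      intro i
      rw [map_sum, Finset.sum_mul_sum]
      refine Finset.sum_congr rfl fun p _ => Finset.sum_congr rfl fun q _ => ?_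
      simp only [map_mul, conj_conj]
      ring
    simp only [e]
    rw [Finset.sum_comm]
    refine Finset.sum_congr rfl fun p _ => ?_
    rw [Finset.sum_comm]
    simp only [← Finset.mul_sum, h.inner_coordinates]
    simp
  simp only [mul_conj] at key
  exact_mod_cast key

/-- Two bases of `ℂ⁶`, given by coordinates, are unbiased. -/
def Unbiased (v v' : Fin 6 → Fin 6 → ℂ) : Prop :=
  ∀ i j, normSq (∑ p, conj (v i p) * v' j p) = 1 / 6

theorem Unbiased.symm {v v' : Fin 6 → Fin 6 → ℂ} (h : Unbiased v v') : Unbiased v' v := by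
  intro i j
  rw [← h j i, ← normSq_conj, map_sum]
  congr 1
  refine Finset.sum_congr rfl fun t _ => ?_
  rw [map_mul, conj_conj, mul_comm]

/-- The support of a vector. -/
noncomputable def coordSupport {n : ℕ} (x : Fin n → ℂ) : Finset (Fin n) := {p | x p ≠ 0}

@[simp]
theorem mem_coordSupport {n : ℕ} {x : Fin n → ℂ} {p : Fin n} : p ∈ coordSupport x ↔ x p ≠ 0 := by
  simp [coordSupport]

theorem sum_conj_mul_eq_sum_coordSupport {n : ℕ} (x y : Fin n → ℂ) :
    ∑ p, conj (x p) * y p = ∑ p ∈ coordSupport x, conj (x p) * y p := by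
  symm
  apply Finset.sum_subset (Finset.subset_univ _)
  intro p _ hp
  rw [mem_coordSupport, not_ne_iff] at hp
  rw [hp, map_zero, zero_mul]

namespace IsBlockFrame

section

variable {n : ℕ} {v : Fin n → Fin n → ℂ}

theorem coordSupport_eq (h : IsBlockFrame v) {i j p : Fin n} (hi : v i p ≠ 0) (hj : v j p ≠ 0) :
    coordSupport (v i) = coordSupport (v j) := by
  ext q
  rw [mem_coordSupport, mem_coordSupport]
  exact ⟨fun hq => h.support i j p q hi hj hq, fun hq => h.support j i p q hj hi hq⟩

theorem card_mul_normSq (h : IsBlockFrame v) {i p : Fin n} (hp : v i p ≠ 0) :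
    (coordSupport (v i)).card * normSq (v i p) = 1 := by
  rw [← h.sum_normSq_vector i, ← nsmul_eq_mul, ← Finset.sum_const]
  rw [Finset.sum_congr rfl fun q hq => h.normSq_eq i p q hp (mem_coordSupport.1 hq)]
  apply Finset.sum_subset (Finset.subset_univ _)
  intro q _ hq
  rw [mem_coordSupport, not_ne_iff] at hq
  rw [hq, map_zero]

theorem exists_ne_zero (h : IsBlockFrame v) (p : Fin n) : ∃ i, v i p ≠ 0 := by
  by_contra! h0
  have := h.sum_normSq_coordinate p
  simp [h0] at this

theorem coordSupport_nonempty (h : IsBlockFrame v) (i : Fin n) : (coordSupport (v i)).Nonempty := by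
  rw [Finset.nonempty_iff_ne_empty]
  intro h0
  have h1 := h.sum_normSq_vector i
  have h2 : ∀ p, v i p = 0 := fun p => by
    have : p ∉ coordSupport (v i) := by simp [h0]
    simpa using this
  simp [h2] at h1

/-- At a coordinate of the block, each vector of the block contributes `1 / |S|` to the row sum 1.
-/
theorem card_same_support (h : IsBlockFrame v) (i : Fin n) :
    (Finset.univ.filter fun j => coordSupport (v j) = coordSupport (v i)).card =
      (coordSupport (v i)).card := by
  obtain ⟨p, hp⟩ := h.coordSupport_nonempty i
  have hp' := mem_coordSupport.1 hp
  have h1 := h.sum_normSq_coordinate p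
  rw [← Finset.sum_subset (Finset.subset_univ
    (Finset.univ.filter fun j => coordSupport (v j) = coordSupport (v i)))] at h1
  · have e : ∀ j ∈ Finset.univ.filter fun j => coordSupport (v j) = coordSupport (v i),
        normSq (v j p) = normSq (v i p) := by
      intro j hj
      rw [Finset.mem_filter] at hj
      have hj' : v j p ≠ 0 := by rw [← mem_coordSupport, hj.2]; exact hp
      have e1 := h.card_mul_normSq hj'
      rw [hj.2, ← h.card_mul_normSq hp'] at e1
      apply mul_left_cancel₀ _ e1
      have : (coordSupport (v i)).card ≠ 0 := (Finset.card_pos.2 ⟨p, hp⟩).ne'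
      exact_mod_cast this
    rw [Finset.sum_congr rfl e, Finset.sum_const, nsmul_eq_mul, ← h.card_mul_normSq hp'] at h1
    have := mul_right_cancel₀ (by simpa using hp') h1
    exact_mod_cast this
  · intro j _ hj
    by_contra h0
    apply hj
    rw [Finset.mem_filter]
    exact ⟨Finset.mem_univ _, h.coordSupport_eq (by simpa using h0) hp'⟩

end

variable {v v' : Fin 6 → Fin 6 → ℂ}

/-- Restrict `v' j` to `S`, the support of `v i`. By flatness its squared norm is `|S ∩ S'| / |S'|`;
by Parseval it is `|S| / 6`, one sixth for each of the `|S|` frame vectors supported on `S`. -/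
theorem card_mul_card (h : IsBlockFrame v) (h' : IsBlockFrame v') (hu : Unbiased v v')
    (i j : Fin 6) : 6 * (coordSupport (v i) ∩ coordSupport (v' j)).card =
      (coordSupport (v i)).card * (coordSupport (v' j)).card := by
  set S := coordSupport (v i)
  set S' := coordSupport (v' j) with hS'
  set x : Fin 6 → ℂ := fun p => if p ∈ S then v' j p else 0 with hx
  have h1 := h.parseval x
  have hl : ∀ k, normSq (∑ p, conj (v k p) * x p) = if coordSupport (v k) = S then 1 / 6 else 0 := by
    intro k
    rw [sum_conj_mul_eq_sum_coordSupport]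
    split_ifs with hk
    · rw [← hu k j, sum_conj_mul_eq_sum_coordSupport]
      congr 1
      refine Finset.sum_congr rfl fun p hp => ?_
      rw [hk] at hp
      simp [hx, hp]
    · rw [Finset.sum_eq_zero, map_zero]
      intro p hp
      rw [mem_coordSupport] at hp
      have : p ∉ S := fun hpS => hk (h.coordSupport_eq hp (mem_coordSupport.1 hpS))
      simp [hx, this]
  have hr : ∑ p, normSq (x p) = ∑ p ∈ S ∩ S', normSq (v' j p) := by
    rw [← Finset.sum_subset (Finset.subset_univ (S ∩ S'))]
    · refine Finset.sum_congr rfl fun p hp => ?_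
      simp [hx, (Finset.mem_inter.1 hp).1]
    · intro p _ hp
      by_cases hpS : p ∈ S
      · have : p ∉ S' := fun h => hp (Finset.mem_inter.2 ⟨hpS, h⟩)
        rw [hS', mem_coordSupport, not_ne_iff] at this
        simp [hx, hpS, this]
      · simp [hx, hpS]
  simp only [hl] at h1
  rw [Finset.sum_ite, Finset.sum_const, Finset.sum_const_zero, add_zero, h.card_same_support i,
    hr, nsmul_eq_mul] at h1
  have h2 : (S'.card : ℝ) * ∑ p ∈ S ∩ S', normSq (v' j p) = (S ∩ S').card := by
    rw [Finset.mul_sum, Finset.sum_congr rfl fun p hp =>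
      h'.card_mul_normSq (mem_coordSupport.1 (Finset.mem_inter.1 hp).2)]
    simp [hS']
  rw [← h1] at h2
  have h3 : ((6 * (S ∩ S').card : ℕ) : ℝ) = (S.card * S'.card : ℕ) := by
    push_cast
    rw [← h2]
    ring
  exact_mod_cast h3

theorem exists_card_le_three (h : IsBlockFrame v) (hf : ¬ IsFullFrame v) :
    ∃ i, (coordSupport (v i)).card ≤ 3 := by
  simp only [IsFullFrame, not_forall, not_ne_iff] at hf
  obtain ⟨i, p, hip⟩ := hf
  obtain ⟨j, hj⟩ := h.exists_ne_zero p
  by_contra! h0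
  have hd : Disjoint (coordSupport (v i)) (coordSupport (v j)) := by
    rw [Finset.disjoint_left]
    intro q hq hq'
    have := h.coordSupport_eq (mem_coordSupport.1 hq) (mem_coordSupport.1 hq')
    rw [← mem_coordSupport, ← this, mem_coordSupport] at hj
    exact hj hip
  have := (Finset.card_union_of_disjoint hd).symm.trans_le (Finset.card_le_univ _)
  have h1 := h0 i
  have h2 := h0 j
  simp at this
  omega

/-- Two frames that are unbiased to each other and not full have a block of size two and one of
size three. -/
theorem card_of_not_full (h : IsBlockFrame v) (h' : IsBlockFrame v') (hu : Unbiased v v')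
    {i j : Fin 6} (hi : (coordSupport (v i)).card ≤ 3) (hj : (coordSupport (v' j)).card ≤ 3) :
    ((coordSupport (v i)).card = 2 ∧ (coordSupport (v' j)).card = 3) ∨
      ((coordSupport (v i)).card = 3 ∧ (coordSupport (v' j)).card = 2) := by
  have h1 := h.card_mul_card h' hu i j
  have h2 := Finset.card_pos.2 (h.coordSupport_nonempty i)
  have h3 := Finset.card_pos.2 (h'.coordSupport_nonempty j)
  generalize (coordSupport (v i)).card = a at *
  generalize (coordSupport (v' j)).card = b at *
  interval_cases a <;> interval_cases b <;> omega

/-- Two terms of squared modulus `1 / 12` have a sum of squared modulus `1 / 6`, so they are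
perpendicular in the plane and their relative phase is `± I`. Comparing `w` with `w'` cancels `v i`
and leaves a sign. -/
theorem eq_or_eq_neg_of_edge (h : IsBlockFrame v) {i p q : Fin 6} (hpq : p ≠ q)
    (hs : coordSupport (v i) = {p, q}) {w w' : Fin 6 → ℂ}
    (hw : ∀ p, normSq (w p) = 1 / 6) (hw' : ∀ p, normSq (w' p) = 1 / 6)
    (hv : normSq (∑ p, conj (v i p) * w p) = 1 / 6)
    (hv' : normSq (∑ p, conj (v i p) * w' p) = 1 / 6) :
    ∃ ε : ℂ, (ε = 1 ∨ ε = -1) ∧ conj (w q) * w' q = ε * (conj (w p) * w' p) := by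
  have hc : (coordSupport (v i)).card = 2 := by rw [hs, Finset.card_pair hpq]
  have hvn : ∀ x ∈ coordSupport (v i), normSq (v i x) = 1 / 2 := by
    intro x hx
    have := h.card_mul_normSq (mem_coordSupport.1 hx)
    rw [hc] at this
    push_cast at this
    linarith
  have hp := hvn p (by simp [hs])
  have hq := hvn q (by simp [hs])
  have key : ∀ w : Fin 6 → ℂ, (∀ p, normSq (w p) = 1 / 6) →
      normSq (∑ p, conj (v i p) * w p) = 1 / 6 → ∃ t : ℝ, t ^ 2 = 1 / 144 ∧
      conj (v i p) * v i q * (w p * conj (w q)) = t * I := by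
    intro w hw hv
    rw [sum_conj_mul_eq_sum_coordSupport, hs, Finset.sum_pair hpq, Complex.normSq_add] at hv
    simp only [normSq_conj, hp, hq, hw, map_mul, conj_conj] at hv
    set z := conj (v i p) * w p * (v i q * conj (w q)) with hz
    have hre : z.re = 0 := by linarith
    have hn : normSq z = 1 / 144 := by
      simp only [hz, normSq_mul, normSq_conj, hp, hq, hw]
      norm_num
    refine ⟨z.im, ?_, ?_⟩
    · rw [normSq_apply, hre] at hn
      linarith
    · have : z = z.im * I := by apply Complex.ext <;> simp [hre]
      rw [← this]
      ring
  obtain ⟨t, ht, et⟩ := key w hw hv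
  obtain ⟨t', ht', et'⟩ := key w' hw' hv'
  have hcp : conj (v i p) * v i p = 1 / 2 := by rw [mul_comm, mul_conj, hp]; norm_num
  have hcq : conj (v i q) * v i q = 1 / 2 := by rw [mul_comm, mul_conj, hq]; norm_num
  have e1 : w p * conj (w q) * conj (w' p) * w' q = ((4 * t * t' : ℝ) : ℂ) := by
    have := congrArg conj et'
    simp only [map_mul, conj_conj, conj_ofReal, conj_I] at this
    push_cast
    have e2 : (conj (v i p) * v i p) * (conj (v i q) * v i q) *
        (w p * conj (w q) * conj (w' p) * w' q) = t * t' := by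
      linear_combination v i p * conj (v i q) * conj (w' p) * w' q * et + t * I * this
        - t * t' * I_sq
    rw [hcp, hcq] at e2
    linear_combination 4 * e2
  have e3 : w p * conj (w p) = 1 / 6 := by rw [mul_conj, hw]; norm_num
  have e4 : w' p * conj (w' p) = 1 / 6 := by rw [mul_conj, hw']; norm_num
  -- Here `t` and `t'` are `± 1 / 12`, so `144 t t'` is a sign.
  have e5 : conj (w q) * w' q = ((144 * t * t' : ℝ) : ℂ) * (conj (w p) * w' p) := by
    push_cast at e1 ⊢
    linear_combination 36 * conj (w p) * w' p * e1 - 6 * conj (w q) * w' q * e3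
      - 36 * (w p * conj (w p)) * conj (w q) * w' q * e4
  refine ⟨_, ?_, e5⟩
  have : (144 * t * t') ^ 2 = 1 := by
    rw [mul_pow, mul_pow, ht, ht']; norm_num
  rcases (by simpa using this : 144 * t * t' = 1 ∨ 144 * t * t' = -1) with h | h
  · left; rw [h]; simp
  · right; rw [h]; simp

/-- Two frame vectors `v a`, `v b` on the triangle supply the hypotheses of `cyclic_sum_eq_zero`, so
the phases of `w` relative to `v a` differ by cube roots of unity. The same holds for `w'`, and `v
a` cancels. -/
theorem exists_cube_root_of_triangle (h : IsBlockFrame v) {i p q r : Fin 6} (hpq : p ≠ q)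
    (hpr : p ≠ r) (hqr : q ≠ r)
    (hs : coordSupport (v i) = {p, q, r}) {w w' : Fin 6 → ℂ}
    (hw : ∀ p, normSq (w p) = 1 / 6) (hw' : ∀ p, normSq (w' p) = 1 / 6)
    (hv : ∀ i, normSq (∑ p, conj (v i p) * w p) = 1 / 6)
    (hv' : ∀ i, normSq (∑ p, conj (v i p) * w' p) = 1 / 6) :
    ∃ z : ℂ, z ^ 3 = 1 ∧ conj (w q) * w' q = z * (conj (w p) * w' p) := by
  have hc : (coordSupport (v i)).card = 3 := by
    rw [hs]
    exact Finset.card_eq_three.2 ⟨p, q, r, hpq, hpr, hqr, rfl⟩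
  have hcc := h.card_same_support i
  rw [hc, Finset.card_eq_three] at hcc
  obtain ⟨a, b, d, hab, -, -, hset⟩ := hcc
  have hsupp : ∀ j, j = a ∨ j = b ∨ j = d → coordSupport (v j) = {p, q, r} := by
    intro j hj
    have : j ∈ Finset.univ.filter fun j => coordSupport (v j) = coordSupport (v i) := by
      rw [hset]; simpa using hj
    rw [← hs]
    exact (Finset.mem_filter.1 this).2
  have hn : ∀ j, j = a ∨ j = b ∨ j = d → ∀ x, x = p ∨ x = q ∨ x = r → normSq (v j x) = 1 / 3 := by
    intro j hj x hx
    have hx' : x ∈ coordSupport (v j) := by rw [hsupp j hj]; simpa using hx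
    have := h.card_mul_normSq (mem_coordSupport.1 hx')
    rw [hsupp j hj, ← hs, hc] at this
    push_cast at this
    linarith
  have hsum : ∀ j, j = a ∨ j = b ∨ j = d → ∀ y : Fin 6 → ℂ, ∑ x, conj (v j x) * y x =
      conj (v j p) * y p + conj (v j q) * y q + conj (v j r) * y r := by
    intro j hj y
    rw [sum_conj_mul_eq_sum_coordSupport, hsupp j hj, Finset.sum_insert (by simp [hpq, hpr]),
      Finset.sum_pair hqr, add_assoc]
  have hi : ∀ j k, j = a ∨ j = b ∨ j = d → j ≠ k →
      conj (v j p) * v k p + conj (v j q) * v k q + conj (v j r) * v k r = 0 := by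
    intro j k hj hjk
    rw [← hsum j hj, h.inner_vectors, if_neg hjk]
  have ha : a = a ∨ a = b ∨ a = d := by simp
  have hb : b = a ∨ b = b ∨ b = d := by simp
  have hp : p = p ∨ p = q ∨ p = r := by simp
  have hq : q = p ∨ q = q ∨ q = r := by simp
  have hr : r = p ∨ r = q ∨ r = r := by simp
  have hone : ∀ x, x = p ∨ x = q ∨ x = r → v a x * conj (v a x) = 1 / 3 := fun x hx => by
    rw [mul_conj, hn a ha x hx]; norm_num
  have key : ∀ w : Fin 6 → ℂ, (∀ p, normSq (w p) = 1 / 6) →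
      (∀ i, normSq (∑ p, conj (v i p) * w p) = 1 / 6) → ∃ z : ℂ, z ^ 3 = 1 ∧
      conj (v a p) * v a q * (w p * conj (w q)) = ((1 / 18 : ℝ) : ℂ) * z := by
    intro w hw hv
    have f0 : ∀ x, x = p ∨ x = q ∨ x = r → normSq (conj (v a x) * w x) = 1 / 18 := fun x hx => by
      rw [normSq_mul, normSq_conj, hn a ha x hx, hw]; norm_num
    have h0 : ∀ j, j = a ∨ j = b ∨ j = d → ∀ x, x = p ∨ x = q ∨ x = r →
        normSq (3 * (conj (v a x) * v j x)) = 1 := fun j hj x hx => by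
      rw [normSq_mul, normSq_mul, normSq_conj, hn a ha x hx, hn j hj x hx, normSq_ofNat]
      norm_num
    have hred : ∀ j x, x = p ∨ x = q ∨ x = r →
        conj (3 * (conj (v a x) * v j x)) * (conj (v a x) * w x) = conj (v j x) * w x := by
      intro j x hx
      simp only [map_mul, conj_conj, map_ofNat]
      linear_combination 3 * conj (v j x) * w x * hone x hx
    have hcs := cyclic_sum_eq_zero (f0 p hp) (f0 q hq) (f0 r hr) (h0 b hb p hp) (h0 b hb q hq)
      (h0 b hb r hr) (by linear_combination 3 * hi a b ha hab)
      (by rw [← hsum a ha w, hv]; norm_num)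
      (by rw [hred b p hp, hred b q hq, hred b r hr, ← hsum b hb w, hv]; norm_num)
    obtain ⟨z, hz, e⟩ := exists_cube_root_of_cyclic_sum (by norm_num) (f0 p hp) (f0 q hq)
      (f0 r hr) hcs
    refine ⟨z, hz, ?_⟩
    rw [← e, map_mul, conj_conj]
    ring
  obtain ⟨z, hz, e⟩ := key w hw hv
  obtain ⟨z', hz', e'⟩ := key w' hw' hv'
  have e1 : w p * conj (w q) * conj (w' p) * w' q = 1 / 36 * (z * conj z') := by
    have := congrArg conj e'
    simp only [map_mul, conj_conj, conj_ofReal] at this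
    push_cast at e this
    have e2 : (v a p * conj (v a p)) * (v a q * conj (v a q)) *
        (w p * conj (w q) * conj (w' p) * w' q) = 1 / 324 * (z * conj z') := by
      linear_combination v a p * conj (v a q) * conj (w' p) * w' q * e + 1 / 18 * z * this
    rw [hone p hp, hone q hq] at e2
    linear_combination 9 * e2
  have e3 : w p * conj (w p) = 1 / 6 := by rw [mul_conj, hw]; norm_num
  have e4 : w' p * conj (w' p) = 1 / 6 := by rw [mul_conj, hw']; norm_num
  refine ⟨z * conj z', ?_, ?_⟩
  · rw [mul_pow, hz, ← map_pow, hz', map_one, mul_one]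
  · linear_combination 36 * conj (w p) * w' p * e1 - 6 * conj (w q) * w' q * e3
      - 36 * (w p * conj (w p)) * conj (w q) * w' q * e4

end IsBlockFrame

namespace IsBlockFrame

variable {v v' : Fin 6 → Fin 6 → ℂ}

theorem false_of_edge_of_triangle (h : IsBlockFrame v) (h' : IsBlockFrame v') (hu : Unbiased v v')
    {i j : Fin 6} (hi : (coordSupport (v i)).card = 2) (hj : (coordSupport (v' j)).card = 3)
    {w w' : Fin 6 → ℂ} (hw : ∀ p, normSq (w p) = 1 / 6) (hw' : ∀ p, normSq (w' p) = 1 / 6)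
    (hvw : ∀ i, normSq (∑ p, conj (v i p) * w p) = 1 / 6)
    (hvw' : ∀ i, normSq (∑ p, conj (v i p) * w' p) = 1 / 6)
    (hv'w : ∀ i, normSq (∑ p, conj (v' i p) * w p) = 1 / 6)
    (hv'w' : ∀ i, normSq (∑ p, conj (v' i p) * w' p) = 1 / 6)
    (hww' : normSq (∑ p, conj (w p) * w' p) = 1 / 6) : False := by
  have h1 := h.card_mul_card h' hu i j
  rw [hi, hj] at h1
  obtain ⟨p, hp⟩ : ∃ p, coordSupport (v i) ∩ coordSupport (v' j) = {p} :=
    Finset.card_eq_one.1 (by omega)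
  have hpS : p ∈ coordSupport (v i) ∩ coordSupport (v' j) := by rw [hp]; simp
  rw [Finset.mem_inter] at hpS
  obtain ⟨p', hp'⟩ : ∃ p', (coordSupport (v i)).erase p = {p'} :=
    Finset.card_eq_one.1 (by rw [Finset.card_erase_of_mem hpS.1, hi])
  have hS : coordSupport (v i) = {p, p'} := by rw [← Finset.insert_erase hpS.1, hp']
  have hpp' : p ≠ p' := by
    rintro rfl
    have : p ∈ (coordSupport (v i)).erase p := by rw [hp']; simp
    simp at this
  have hp'j : p' ∉ coordSupport (v' j) := by
    intro hh
    have : p' ∈ coordSupport (v i) ∩ coordSupport (v' j) :=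
      Finset.mem_inter.2 ⟨by rw [hS]; simp, hh⟩
    rw [hp, Finset.mem_singleton] at this
    exact hpp' this.symm
  obtain ⟨k, hk⟩ := h'.exists_ne_zero p'
  have hk' := mem_coordSupport.2 hk
  have hd : Disjoint (coordSupport (v' j)) (coordSupport (v' k)) := by
    rw [Finset.disjoint_left]
    intro q hq hq'
    have := h'.coordSupport_eq (mem_coordSupport.1 hq) (mem_coordSupport.1 hq')
    exact hp'j (this ▸ hk')
  -- The count against the edge makes this size a multiple of 3, and it is at most 3 by
  -- disjointness. The two triangles thus fill all coordinates and the edge joins them.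
  have hcard : (coordSupport (v' k)).card = 3 := by
    have h2 := h.card_mul_card h' hu i k
    have h3 := (Finset.card_union_of_disjoint hd).symm.trans_le (Finset.card_le_univ _)
    have h4 := Finset.card_pos.2 ⟨p', hk'⟩
    rw [hi] at h2
    simp only [Fintype.card_fin] at h3
    omega
  have huniv : coordSupport (v' j) ∪ coordSupport (v' k) = Finset.univ := by
    apply Finset.eq_univ_of_card
    rw [Finset.card_union_of_disjoint hd, hj, hcard, Fintype.card_fin]
  have htri : ∀ k p, (coordSupport (v' k)).card = 3 → p ∈ coordSupport (v' k) →
      ∃ y z : ℂ, y ^ 3 = 1 ∧ z ^ 3 = 1 ∧ ∑ q ∈ coordSupport (v' k), conj (w q) * w' q =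
        conj (w p) * w' p + y * (conj (w p) * w' p) + z * (conj (w p) * w' p) := by
    intro k p hk hp
    obtain ⟨q, r, hqr, he⟩ : ∃ q r, q ≠ r ∧ (coordSupport (v' k)).erase p = {q, r} :=
      Finset.card_eq_two.1 (by rw [Finset.card_erase_of_mem hp, hk])
    have hT : coordSupport (v' k) = {p, q, r} := by rw [← Finset.insert_erase hp, he]
    have hpn : p ∉ ({q, r} : Finset (Fin 6)) := by rw [← he]; simp
    have hpq : p ≠ q := fun h => hpn (by simp [h])
    have hpr : p ≠ r := fun h => hpn (by simp [h])
    obtain ⟨y, hy, ey⟩ := h'.exists_cube_root_of_triangle hpq hpr hqr hT hw hw' hv'w hv'w'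
    have hT' : coordSupport (v' k) = {p, r, q} := by rw [hT, Finset.pair_comm]
    obtain ⟨z, hz, ez⟩ := h'.exists_cube_root_of_triangle hpr hpq hqr.symm hT' hw hw' hv'w hv'w'
    refine ⟨y, z, hy, hz, ?_⟩
    rw [hT, Finset.sum_insert hpn, Finset.sum_pair hqr, ey, ez, add_assoc]
  obtain ⟨z₁, z₂, hz₁, hz₂, e₁⟩ := htri j p hj hpS.2
  obtain ⟨z₃, z₄, hz₃, hz₄, e₂⟩ := htri k p' hcard hk'
  obtain ⟨ε, hε, e₃⟩ := h.eq_or_eq_neg_of_edge hpp' hS hw hw' (hvw i) (hvw' i)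
  rw [← huniv, Finset.sum_union hd, e₁, e₂, e₃] at hww'
  refine normSq_sum_ne_of_cube_roots (n := 1 / 36) (by norm_num) ?_ hε hz₁ hz₂ hz₃ hz₄
    (hww'.trans (by norm_num))
  rw [normSq_mul, normSq_conj, hw, hw']
  norm_num

theorem normSq_of_full (h : IsBlockFrame v) (hf : IsFullFrame v) (i p : Fin 6) :
    normSq (v i p) = 1 / 6 := by
  have h1 := h.card_mul_normSq (hf i p)
  have : coordSupport (v i) = Finset.univ := by
    ext q
    simpa using hf i q
  rw [this] at h1
  simp at h1
  linarith

end IsBlockFrame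

/-! ### Combining the cases, and the passage from orthonormal bases to frames. -/

/-- A block frame that comes from a class of monomial matrices: if it is full, then the vectors
that are unbiased to the coordinate vectors and to the frame are cyclic six-roots. -/
structure IsMonomialFrame (v : Fin 6 → Fin 6 → ℂ) : Prop extends IsBlockFrame v where
  exists_cyclicSixRoot : IsFullFrame v →
    ∃ φ : Fin 2 × Fin 3 ≃ Fin 6, ∀ w : Fin 6 → ℂ, (∀ p, normSq (w p) = 1 / 6) →
      (∀ i, normSq (∑ p, conj (v i p) * w p) = 1 / 6) →
      CyclicSixRoot (fun t => 6 * conj (v 0 (φ (0, t))) * w (φ (0, t)))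
        (fun t => 6 * conj (v 0 (φ (1, t))) * w (φ (1, t)))

namespace IsMonomialFrame

theorem false_of_full {v₁ v₂ v₃ : Fin 6 → Fin 6 → ℂ} (h₁ : IsMonomialFrame v₁)
    (h₂ : IsMonomialFrame v₂) (h₃ : IsMonomialFrame v₃) (u₁₂ : Unbiased v₁ v₂)
    (u₁₃ : Unbiased v₁ v₃) (u₂₃ : Unbiased v₂ v₃) (f₁ : IsFullFrame v₁) (f₂ : IsFullFrame v₂)
    (f₃ : IsFullFrame v₃) : False := by
  obtain ⟨φ, hφ⟩ := h₁.exists_cyclicSixRoot f₁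
  have hc₂ := fun j => hφ (v₂ j) (h₂.normSq_of_full f₂ j) (fun i => u₁₂ i j)
  have hc₃ := fun j => hφ (v₃ j) (h₃.normSq_of_full f₃ j) (fun i => u₁₃ i j)
  have hone : ∀ p, v₁ 0 p * conj (v₁ 0 p) = 1 / 6 := fun p => by
    rw [mul_conj, h₁.normSq_of_full f₁]; norm_num
  have horth : ∀ v : Fin 6 → Fin 6 → ℂ, IsMonomialFrame v →
      ∑ i, conj (6 * conj (v₁ 0 (φ (0, 0))) * v i (φ (0, 0))) *
        (6 * conj (v₁ 0 (φ (1, 0))) * v i (φ (1, 0))) = 0 := by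
    intro v hv
    -- Orthogonality of two coordinates over the basis is what the flat case violates.
    have h0 := hv.inner_coordinates (φ (1, 0)) (φ (0, 0))
    rw [if_neg (fun h => by simpa using φ.injective h)] at h0
    have e : ∀ i, conj (6 * conj (v₁ 0 (φ (0, 0))) * v i (φ (0, 0))) *
        (6 * conj (v₁ 0 (φ (1, 0))) * v i (φ (1, 0))) =
        36 * v₁ 0 (φ (0, 0)) * conj (v₁ 0 (φ (1, 0))) *
          (v i (φ (1, 0)) * conj (v i (φ (0, 0)))) := by
      intro i
      simp only [map_mul, conj_conj, map_ofNat]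
      ring
    rw [Finset.sum_congr rfl fun i _ => e i, ← Finset.mul_sum, h0, mul_zero]
  refine CyclicSixRoot.false_of_unbiased hc₂ hc₃ (fun i j => ?_) (horth v₂ h₂) (horth v₃ h₃)
  have e : ∑ t, (conj (6 * conj (v₁ 0 (φ (0, t))) * v₂ i (φ (0, t))) *
      (6 * conj (v₁ 0 (φ (0, t))) * v₃ j (φ (0, t))) +
      conj (6 * conj (v₁ 0 (φ (1, t))) * v₂ i (φ (1, t))) *
      (6 * conj (v₁ 0 (φ (1, t))) * v₃ j (φ (1, t)))) = 6 * ∑ p, conj (v₂ i p) * v₃ j p := by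
    rw [← Equiv.sum_comp φ, Fintype.sum_prod_type, Fin.sum_univ_two, ← Finset.sum_add_distrib,
      Finset.mul_sum]
    refine Finset.sum_congr rfl fun t _ => ?_
    simp only [map_mul, conj_conj, map_ofNat]
    linear_combination 36 * conj (v₂ i (φ (0, t))) * v₃ j (φ (0, t)) * hone (φ (0, t))
      + 36 * conj (v₂ i (φ (1, t))) * v₃ j (φ (1, t)) * hone (φ (1, t))
  rw [e, normSq_mul, u₂₃ i j, normSq_ofNat]
  norm_num

theorem false_of_not_full {v₁ v₂ v₃ : Fin 6 → Fin 6 → ℂ} (h₁ : IsMonomialFrame v₁)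
    (h₂ : IsMonomialFrame v₂) (h₃ : IsMonomialFrame v₃) (u₁₂ : Unbiased v₁ v₂)
    (u₁₃ : Unbiased v₁ v₃) (u₂₃ : Unbiased v₂ v₃) (f₁ : ¬ IsFullFrame v₁) (f₂ : ¬ IsFullFrame v₂)
    (f₃ : ¬ IsFullFrame v₃) : False := by
  obtain ⟨i, hi⟩ := h₁.exists_card_le_three f₁
  obtain ⟨j, hj⟩ := h₂.exists_card_le_three f₂
  obtain ⟨k, hk⟩ := h₃.exists_card_le_three f₃
  have h12 := h₁.card_of_not_full h₂.toIsBlockFrame u₁₂ hi hj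
  have h13 := h₁.card_of_not_full h₃.toIsBlockFrame u₁₃ hi hk
  have h23 := h₂.card_of_not_full h₃.toIsBlockFrame u₂₃ hj hk
  omega

theorem false_of_not_full_of_full {v₁ v₂ v₃ v₄ : Fin 6 → Fin 6 → ℂ} (h₁ : IsMonomialFrame v₁)
    (h₂ : IsMonomialFrame v₂) (h₃ : IsMonomialFrame v₃) (h₄ : IsMonomialFrame v₄)
    (u₁₂ : Unbiased v₁ v₂) (u₁₃ : Unbiased v₁ v₃) (u₁₄ : Unbiased v₁ v₄) (u₂₃ : Unbiased v₂ v₃)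
    (u₂₄ : Unbiased v₂ v₄) (u₃₄ : Unbiased v₃ v₄) (f₁ : ¬ IsFullFrame v₁)
    (f₂ : ¬ IsFullFrame v₂) (f₃ : IsFullFrame v₃) (f₄ : IsFullFrame v₄) : False := by
  obtain ⟨i, hi⟩ := h₁.exists_card_le_three f₁
  obtain ⟨j, hj⟩ := h₂.exists_card_le_three f₂
  have n₃ := h₃.normSq_of_full f₃ 0
  have n₄ := h₄.normSq_of_full f₄ 0
  rcases h₁.card_of_not_full h₂.toIsBlockFrame u₁₂ hi hj with ⟨ci, cj⟩ | ⟨ci, cj⟩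
  · exact h₁.false_of_edge_of_triangle h₂.toIsBlockFrame u₁₂ ci cj n₃ n₄ (fun i => u₁₃ i 0)
      (fun i => u₁₄ i 0) (fun i => u₂₃ i 0) (fun i => u₂₄ i 0) (u₃₄ 0 0)
  · exact h₂.false_of_edge_of_triangle h₁.toIsBlockFrame u₁₂.symm cj ci n₃ n₄ (fun i => u₂₃ i 0)
      (fun i => u₂₄ i 0) (fun i => u₁₃ i 0) (fun i => u₁₄ i 0) (u₃₄ 0 0)

theorem card_le_three {m : ℕ} {v : Fin m → Fin 6 → Fin 6 → ℂ} (h : ∀ k, IsMonomialFrame (v k))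
    (hu : ∀ k l, k ≠ l → Unbiased (v k) (v l)) : m ≤ 3 := by
  by_contra! hm
  have H1 : ∀ a b d, a ≠ b → a ≠ d → b ≠ d → IsFullFrame (v a) → IsFullFrame (v b) →
      IsFullFrame (v d) → False := fun a b d hab had hbd =>
    false_of_full (h a) (h b) (h d) (hu a b hab) (hu a d had) (hu b d hbd)
  have H2 : ∀ a b d, a ≠ b → a ≠ d → b ≠ d → ¬ IsFullFrame (v a) → ¬ IsFullFrame (v b) →
      ¬ IsFullFrame (v d) → False := fun a b d hab had hbd =>
    false_of_not_full (h a) (h b) (h d) (hu a b hab) (hu a d had) (hu b d hbd)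
  have H3 : ∀ a b d e, a ≠ b → a ≠ d → a ≠ e → b ≠ d → b ≠ e → d ≠ e → ¬ IsFullFrame (v a) →
      ¬ IsFullFrame (v b) → IsFullFrame (v d) → IsFullFrame (v e) → False :=
    fun a b d e hab had hae hbd hbe hde =>
    false_of_not_full_of_full (h a) (h b) (h d) (h e) (hu a b hab) (hu a d had) (hu a e hae)
      (hu b d hbd) (hu b e hbe) (hu d e hde)
  obtain ⟨a, b, d, e, hab, had, hae, hbd, hbe, hde⟩ : ∃ a b d e : Fin m,
      a ≠ b ∧ a ≠ d ∧ a ≠ e ∧ b ≠ d ∧ b ≠ e ∧ d ≠ e :=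
    ⟨⟨0, by omega⟩, ⟨1, by omega⟩, ⟨2, by omega⟩, ⟨3, by omega⟩, by simp, by simp, by simp,
      by simp, by simp, by simp⟩
  clear hu h
  -- Only the pattern of full and not full frames among the four indices matters from here on.
  generalize hF : (fun k => IsFullFrame (v k)) = F at *
  replace hF : ∀ k, IsFullFrame (v k) = F k := fun k => by rw [← hF]
  simp only [hF] at H1 H2 H3
  by_cases fa : F a <;> by_cases fb : F b <;> by_cases fd : F d <;> by_cases fe : F e <;> grind

end IsMonomialFrame

theorem isMonomialFrame_of_areCommonEigenvectors
    {C : Finset (Matrix (Fin 6) (Fin 6) ℂ)} (hC : IsMaximalCommutingClass C)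
    (hm : ∀ A ∈ C, IsMonomialMatrix A) (b : OrthonormalBasis (Fin 6) ℂ (EuclideanSpace ℂ (Fin 6)))
    (he : AreCommonEigenvectors C b) : IsMonomialFrame (fun i p => b i p) := by
  have h1 : ∀ i j, ∑ p, conj (b i p) * b j p = if i = j then 1 else 0 := by
    intro i j
    rw [← orthonormal_iff_ite.1 b.orthonormal i j, PiLp.inner_apply]
    refine Finset.sum_congr rfl fun p _ => ?_
    rw [RCLike.inner_apply, mul_comm]
  have h2 : ∀ p q, ∑ i, b i p * conj (b i q) = if p = q then 1 else 0 := by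
    let M : Matrix (Fin 6) (Fin 6) ℂ := fun p i => b i p
    have hM : M.conjTranspose * M = 1 := by
      ext i j
      rw [Matrix.mul_apply, Matrix.one_apply, ← h1 i j]
      rfl
    have hM' : M * M.conjTranspose = 1 := mul_eq_one_comm.1 hM
    intro p q
    have := congrFun (congrFun hM' p) q
    rw [Matrix.mul_apply, Matrix.one_apply] at this
    rw [← this]
    rfl
  choose c hc using he
  classical
  have hframe : IsEigenframe C (fun i p => b i p)
      (fun A i => if hA : A ∈ C then c A hA i else 0) :=
    { inner_vectors := h1
      inner_coordinates := h2
      isClass := hC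
      mulVec := by
        intro A hA i
        rw [dif_pos hA]
        have := (hc A hA i).apply_eq_smul
        have := congrArg (fun x : EuclideanSpace ℂ (Fin 6) => x.ofLp) this
        simpa [Matrix.toLpLin_apply] using this }
  exact ⟨hframe.isBlockFrame hm, hframe.exists_cyclicSixRoot hm⟩

theorem mainTheorem4 (m : ℕ)
    (B : Fin m → OrthonormalBasis (Fin 6) ℂ (EuclideanSpace ℂ (Fin 6)))
    (hunbiased : ∀ k l, k ≠ l → MutuallyUnbiased (B k) (B l))
    (hmonomial : IsMonomialCollection B) :
    m ≤ 3 := by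
  obtain ⟨U, hU, hC⟩ := hmonomial
  have hU' : U * U.conjTranspose = 1 := Matrix.mem_unitaryGroup_iff.1 hU
  have hinner : ∀ x y : EuclideanSpace ℂ (Fin 6), inner ℂ (Matrix.toEuclideanLin U.conjTranspose x)
      (Matrix.toEuclideanLin U.conjTranspose y) = inner ℂ x y := by
    intro x y
    rw [Matrix.toEuclideanLin_conjTranspose_eq_adjoint, LinearMap.adjoint_inner_left,
      ← Matrix.toEuclideanLin_conjTranspose_eq_adjoint]
    congr 1
    simp [Matrix.toLpLin_apply, hU']
  have hon : ∀ k, Orthonormal ℂ fun i => Matrix.toEuclideanLin U.conjTranspose (B k i) := by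
    intro k
    rw [orthonormal_iff_ite]
    intro i j
    rw [hinner]
    exact orthonormal_iff_ite.1 (B k).orthonormal i j
  have hb : ∀ k, ∃ b : OrthonormalBasis (Fin 6) ℂ (EuclideanSpace ℂ (Fin 6)),
      ⇑b = fun i => Matrix.toEuclideanLin U.conjTranspose (B k i) := fun k =>
    ⟨OrthonormalBasis.mk (hon k)
      ((hon k).linearIndependent.span_eq_top_of_card_eq_finrank (by simp)).ge,
      OrthonormalBasis.coe_mk _ _⟩
  choose b hb using hb
  refine IsMonomialFrame.card_le_three (v := fun k i p => b k i p) (fun k => ?_) ?_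
  · obtain ⟨C, h1, h2, h3⟩ := hC k
    exact isMonomialFrame_of_areCommonEigenvectors h1 h3 (b k) (by rw [hb k]; exact h2)
  · intro k l hkl i j
    have h1 := hunbiased k l hkl i j
    rw [← hinner, ← congrFun (hb k) i, ← congrFun (hb l) j, ← normSq_eq_norm_sq,
      PiLp.inner_apply] at h1
    push_cast at h1
    rw [← h1]
    congr 1
    refine Finset.sum_congr rfl fun p _ => ?_
    rw [RCLike.inner_apply, mul_comm]
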